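/- Write $B_1=\{x\in\mathbb R^2:|x|<1\}$. Let $\alpha>-1$ with $\alpha\notin\mathbb N\cup\{0\}$. Then there are smooth functions $h_k$ on $B_1$, functions $u_k\in C(\overline{B_1})\cap C^2(B_1\setminus\{0\})$ $(k=1,2,\dots)$ and constants $c_1,c,C>0$ independent of $k$ with the following properties. 1. $\frac1{c_1}\le h_k\le c_1$ and $|\nabla^j h_k|\le c_1$ in $B_1$ for $j=1,2,3$. 2. $u_k$ solves $\Delta u_k+|x|^{2\alpha}h_k(x)e^{u_k}=0$ in $B_1$, pointwise in $B_1\setminus\{0\}$ and in the sense of distributions in all of $B_1$. 3. If $\psi_k\in C(\overline{B_1})$ is the solution of $\Delta\psi_k=0$ in $B_1$, $\psi_k=u_k-\frac1{2\pi}\int_{\partial B_1}u_k\,ds$ on $\partial B_1$, then for all $k$ $$|\nabla\log h_k(0)+\nabla\psi_k(0)|\ge c,\qquad |\Delta\log h_k(0)|\ge c.$$ 4. The origin is the only blow-up point of $(u_k)$: there are $x_k\to0$ in $B_1$ with $u_k(x_k)\to+\infty$, while for no $p\in\overline{B_1}\setminus\{0\}$ and no subsequence $(u_{k_j})$ are there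 $x_j\in B_1$ with $x_j\to p$ and $u_{k_j}(x_j)\to+\infty$. 5. $|u_k(x)-u_k(y)|\le C$ for all $x,y\in\partial B_1$ and all $k$. 6. $\int_{B_1}|x|^{2\alpha}h_ke^{u_k}\,dx<C$ for all $k$. 7. (Spherical Harnack inequality) $|u_k(x)-u_k(y)|\le C$ for all $k$ and all $x,y\in B_1\setminus\{0\}$ with $|x|=|y|$. -/

import Mathlib

open Set Filter Topology MeasureTheory Metric InnerProductSpace
open scoped ContDiff Real

/-- The plane is `ℂ` with its real Euclidean structure, and `B₁ = ball 0 1`.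
`IsLiouvilleSolution α h u` says that `u`, continuous up to the boundary, solves
`Δ u + |x| ^ (2 α) h e ^ u = 0` in `B₁`: classically away from the origin, where the weight
`|x| ^ (2 α)` may be singular or not smooth, and in the sense of distributions on all of `B₁`, so
that there is no point mass at the origin. -/
structure IsLiouvilleSolution (α : ℝ) (h u : ℂ → ℝ) : Prop where
  continuousOn : ContinuousOn u (closedBall 0 1)
  contDiffOn : ContDiffOn ℝ 2 u (ball 0 1 \ {0})
  classical : ∀ x ∈ ball (0 : ℂ) 1 \ {0},
    Laplacian.laplacian u x + ‖x‖ ^ (2 * α) * h x * Real.exp (u x) = 0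
  distributional : ∀ φ : ℂ → ℝ, ContDiff ℝ ∞ φ → HasCompactSupport φ → tsupport φ ⊆ ball 0 1 →
    (∫ x in ball (0 : ℂ) 1, u x * Laplacian.laplacian φ x)
      + ∫ x in ball (0 : ℂ) 1, ‖x‖ ^ (2 * α) * h x * Real.exp (u x) * φ x = 0

/-- The coefficient bounds: each `h k` is smooth on `B₁`, `1 / c₁ ≤ h k ≤ c₁`, and the derivatives
of orders one, two and three are bounded by `c₁` on `B₁`. -/
def CoefficientBounds (h : ℕ → ℂ → ℝ) (c₁ : ℝ) : Prop :=
  ∀ k, ContDiffOn ℝ ∞ (h k) (ball 0 1) ∧ ∀ x ∈ ball (0 : ℂ) 1,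
    1 / c₁ ≤ h k x ∧ h k x ≤ c₁ ∧ ∀ n ∈ Finset.Icc 1 3, ‖iteratedFDeriv ℝ n (h k) x‖ ≤ c₁

/-- `p` is a blow-up point of the sequence `u` of functions on `B₁`. -/
def IsBlowUpPoint (u : ℕ → ℂ → ℝ) (p : ℂ) : Prop :=
  ∃ x : ℕ → ℂ, (∀ k, x k ∈ ball 0 1) ∧ Tendsto x atTop (𝓝 p) ∧
    Tendsto (fun k => u k (x k)) atTop atTop

/-- The sequence `u` blows up at the origin, and no subsequence of it blows up at any other point
of the closed unit disc. -/
def BlowsUpOnlyAtOrigin (u : ℕ → ℂ → ℝ) : Prop :=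
  IsBlowUpPoint u 0 ∧ ∀ σ : ℕ → ℕ, StrictMono σ → ∀ p ∈ closedBall (0 : ℂ) 1,
    IsBlowUpPoint (fun k => u (σ k)) p → p = 0

/-- Bounded oscillation on `∂B₁`, uniformly in `k`. -/
def BoundedBoundaryOscillation (u : ℕ → ℂ → ℝ) : Prop :=
  ∃ C : ℝ, ∀ k, ∀ x ∈ sphere (0 : ℂ) 1, ∀ y ∈ sphere (0 : ℂ) 1, |u k x - u k y| ≤ C

/-- `∫_{B₁} |x| ^ (2 α) h k e ^ (u k)` is finite and bounded uniformly in `k`. -/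
def BoundedEnergy (α : ℝ) (h u : ℕ → ℂ → ℝ) : Prop :=
  ∃ C : ℝ, ∀ k,
    IntegrableOn (fun x : ℂ => ‖x‖ ^ (2 * α) * h k x * Real.exp (u k x)) (ball 0 1) ∧
    ∫ x in ball (0 : ℂ) 1, ‖x‖ ^ (2 * α) * h k x * Real.exp (u k x) < C

/-- The spherical Harnack inequality around the origin: the oscillation of `u k` on the circle
of radius `r` about the origin is bounded uniformly in `k` and in `0 < r < 1`. -/
def SphericalHarnack (u : ℕ → ℂ → ℝ) : Prop :=
  ∃ C : ℝ, ∀ k, ∀ r : ℝ, 0 < r → r < 1 →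
    ∀ x ∈ sphere (0 : ℂ) r, ∀ y ∈ sphere (0 : ℂ) r, |u k x - u k y| ≤ C

/-- `ψ` is the solution of the Dirichlet problem `Δ ψ = 0` in `B₁`,
`ψ = u - (1 / 2π) ∫_{∂B₁} u` on `∂B₁`. -/
structure IsBoundaryHarmonicPart (u ψ : ℂ → ℝ) : Prop where
  continuousOn : ContinuousOn ψ (closedBall 0 1)
  harmonic : HarmonicOnNhd ψ (ball 0 1)
  boundary : ∀ x ∈ sphere (0 : ℂ) 1, ψ x = u x - Real.circleAverage u 0 1

/-!
The construction rests on the conformal covariance of the Liouville equation. If `ũ` is a radial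
solution of `Δ ũ + |y| ^ (2α) h̃ e ^ ũ = 0` and `H z = z e ^ (β z)`, then
`u = ũ ∘ H + log |H'| ^ 2 + 2α log |H / z|` solves the equation with coefficient `h = h̃ ∘ H`. The
additional terms are harmonic and bounded. Hence the blow-up behaviour, the energy bound and the
spherical Harnack inequality are those of the radial solution, up to bounded errors, whereas the
boundary values of `u` acquire a part with a nonvanishing gradient. The radial coefficient is
`h̃ = exp (b r ^ 2)` with a small fixed `b > 0`; then the same `h` serves for
the whole sequence, `∇ log h` vanishes at the origin, and `Δ log h 0 = 4 b`.

With `p = 2 + 2α` and `s = r ^ p` the radial problem becomes `(s v')' = -k(s) e ^ v` with a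
continuous coefficient `k`, and is solved by a Volterra iteration (`exists_radial_liouville`). The
mass `m = -s v'` is controlled by the first integral `s m' - m + m ^ 2 / 2`, which would vanish for
constant `k` and here lies between `0` and `δ m` with `δ` proportional to `b`
(`IsRadialProfile.firstIntegral_mem_Icc`). This bounds `m` and `s m'` independently of `v 0`, and
shows that `m` is close to `2` away from the origin as soon as `v 0` is large
(`IsRadialProfile.two_sub_mass_le`).

So on the unit circle `ũ ∘ H` is close to a constant plus `-2 p log |H| = -2 p β Re z`, and `u` is
close to a constant plus the trace of `2 log |1 + β z| - p β Re z`. This harmonic function has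
gradient `(2 - p) β = -2αβ` at the origin, which is nonzero since `α ≠ 0`. The error is estimated
by the Poisson formula (`abs_fderiv_boundaryHarmonicPart_sub_le`).

The equation holds in the sense of distributions because `u` is continuous at the origin
(`integral_mul_laplacian_add_eq_zero`). All estimates are carried out on the disc of radius `2`,
so that the energy in the unit disc can be bounded by testing the equation with a cut-off function.
-/

/-! ### A singular Volterra equation -/

/-- The running mean `σ ↦ ∫₀¹ w (σ s) ds = σ⁻¹ ∫₀^σ w`, which also makes sense at `σ = 0`. -/
noncomputable def runningMean (w : ℝ → ℝ) (σ : ℝ) : ℝ := ∫ s in (0 : ℝ)..1, w (σ * s)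

lemma continuous_runningMean {w : ℝ → ℝ} (hw : Continuous w) : Continuous (runningMean w) := by
  unfold runningMean
  exact intervalIntegral.continuous_parametric_intervalIntegral_of_continuous' (by fun_prop) 0 1

lemma runningMean_zero (w : ℝ → ℝ) : runningMean w 0 = w 0 := by simp [runningMean]

lemma mul_runningMean (w : ℝ → ℝ) (σ : ℝ) : σ * runningMean w σ = ∫ s in (0 : ℝ)..σ, w s := by
  simp [runningMean]

lemma hasDerivAt_mul_runningMean {w : ℝ → ℝ} (hw : Continuous w) (σ : ℝ) :
    HasDerivAt (fun σ => σ * runningMean w σ) (w σ) σ := by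
  simp_rw [mul_runningMean]
  exact hw.integral_hasStrictDerivAt 0 σ |>.hasDerivAt

lemma runningMean_nonneg {w : ℝ → ℝ} (hw : ∀ s, 0 ≤ w s) (σ : ℝ) : 0 ≤ runningMean w σ :=
  intervalIntegral.integral_nonneg zero_le_one fun _ _ => hw _

/-- One application of the Volterra operator `w ↦ ∫₀^σ τ⁻¹ ∫₀^τ w` raises the order of vanishing
at the origin by one. -/
lemma abs_integral_runningMean_sub_le {w₁ w₂ : ℝ → ℝ} (h₁ : Continuous w₁) (h₂ : Continuous w₂)
    {L C : ℝ} {n : ℕ} (h : ∀ s ∈ Icc 0 L, |w₁ s - w₂ s| ≤ C * s ^ n) {σ : ℝ} (hσ : σ ∈ Icc 0 L) :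
    |(∫ s in (0 : ℝ)..σ, runningMean w₁ s) - ∫ s in (0 : ℝ)..σ, runningMean w₂ s|
      ≤ C * (σ ^ (n + 1) / (n + 1)) := by
  have hmean : ∀ t ∈ Icc 0 L, |runningMean w₁ t - runningMean w₂ t| ≤ C * t ^ n := by
    intro t ht
    unfold runningMean
    rw [← intervalIntegral.integral_sub
      ((by fun_prop : Continuous fun s => w₁ (t * s)).intervalIntegrable _ _)
      ((by fun_prop : Continuous fun s => w₂ (t * s)).intervalIntegrable _ _)]
    have : ‖∫ s in (0 : ℝ)..1, (w₁ (t * s) - w₂ (t * s))‖ ≤ C * t ^ n * |1 - 0| := by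
      apply intervalIntegral.norm_integral_le_of_norm_le_const
      intro s hs
      rw [uIoc_of_le zero_le_one] at hs
      have hC : 0 ≤ C * t ^ n := (abs_nonneg _).trans (h t ht)
      have hts : t * s ∈ Icc 0 L :=
        ⟨mul_nonneg ht.1 hs.1.le, (mul_le_of_le_one_right ht.1 hs.2).trans ht.2⟩
      calc ‖w₁ (t * s) - w₂ (t * s)‖ ≤ C * (t * s) ^ n := h _ hts
        _ = C * t ^ n * s ^ n := by ring
        _ ≤ C * t ^ n * 1 := by gcongr; exact pow_le_one₀ hs.1.le hs.2
        _ = _ := by ring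
    simpa using this
  have c₁ := continuous_runningMean h₁
  have c₂ := continuous_runningMean h₂
  rw [← intervalIntegral.integral_sub (c₁.intervalIntegrable _ _) (c₂.intervalIntegrable _ _)]
  calc |∫ s in (0 : ℝ)..σ, (runningMean w₁ s - runningMean w₂ s)|
      ≤ ∫ s in (0 : ℝ)..σ, |runningMean w₁ s - runningMean w₂ s| :=
        intervalIntegral.abs_integral_le_integral_abs hσ.1
    _ ≤ ∫ s in (0 : ℝ)..σ, C * s ^ n := by
        apply intervalIntegral.integral_mono_on hσ.1
        · exact (c₁.sub c₂).abs.intervalIntegrable _ _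
        · exact (by fun_prop : Continuous fun s : ℝ => C * s ^ n).intervalIntegrable _ _
        · exact fun s hs => hmean s ⟨hs.1, hs.2.trans hσ.2⟩
    _ = _ := by simp [intervalIntegral.integral_const_mul, integral_pow]

lemma abs_exp_min_sub_le (a b c : ℝ) :
    |Real.exp (min a c) - Real.exp (min b c)| ≤ Real.exp c * |a - b| := by
  have key : ∀ x y : ℝ, x ≤ y → Real.exp (min y c) - Real.exp (min x c)
      ≤ Real.exp c * (y - x) := by
    intro x y hxy
    have h1 : min x c ≤ min y c := min_le_min_right c hxy
    have h2 : min y c - min x c ≤ y - x := by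
      rcases le_total y c with h | h <;> rcases le_total x c with h' | h' <;>
        simp [h, h'] <;> linarith
    have h3 : 1 - (min y c - min x c) ≤ Real.exp (min x c - min y c) := by
      have := Real.add_one_le_exp (min x c - min y c); linarith
    have h4 : Real.exp (min x c) = Real.exp (min y c) * Real.exp (min x c - min y c) := by
      rw [← Real.exp_add]; ring_nf
    have h5 : Real.exp (min y c) ≤ Real.exp c := Real.exp_le_exp.2 (min_le_right _ _)
    have h6 := Real.exp_pos (min y c)
    calc Real.exp (min y c) - Real.exp (min x c)
        = Real.exp (min y c) * (1 - Real.exp (min x c - min y c)) := by rw [h4]; ring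
      _ ≤ Real.exp (min y c) * (min y c - min x c) :=
          mul_le_mul_of_nonneg_left (by linarith) h6.le
      _ ≤ Real.exp c * (y - x) := by gcongr
  rcases le_total a b with h | h
  · rw [abs_sub_comm, abs_sub_comm a b, abs_of_nonneg (sub_nonneg.2 h), abs_of_nonneg]
    · exact key a b h
    · exact sub_nonneg.2 (Real.exp_le_exp.2 (min_le_min_right c h))
  · rw [abs_of_nonneg (sub_nonneg.2 h), abs_of_nonneg]
    · exact key b a h
    · exact sub_nonneg.2 (Real.exp_le_exp.2 (min_le_min_right c h))

/-- The radial Liouville problem `(σ v')' = -k e ^ v`, `v 0 = v₀`, is solvable on `[0, L]`.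
The truncated nonlinearity `e ^ min v v₀` is Lipschitz, and an iterate of the corresponding
Volterra operator is a contraction; the truncation is void because `v` decreases. Here `g = -v'`,
and the right side `f` is extended continuously to `ℝ`, so that the differential relations hold
on the whole line. -/
lemma exists_radial_liouville {k : ℝ → ℝ} (hk : Continuous k) (hk0 : ∀ s, 0 ≤ k s) {L : ℝ}
    (hL : 0 ≤ L) (v₀ : ℝ) :
    ∃ v g f : ℝ → ℝ, Continuous g ∧ Continuous f ∧ v 0 = v₀ ∧ g 0 = f 0 ∧
      (∀ s, HasDerivAt v (-g s) s) ∧ (∀ s, HasDerivAt (fun s => s * g s) (f s) s) ∧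
      ∀ s ∈ Icc 0 L, f s = k s * Real.exp (v s) := by
  let F : C(Icc 0 L, ℝ) → ℝ → ℝ := fun w s =>
    k (projIcc 0 L hL s) * Real.exp (min (w (projIcc 0 L hL s)) v₀)
  have hF : ∀ w, Continuous (F w) := fun w => by
    have := continuous_projIcc (h := hL)
    fun_prop
  have hF0 : ∀ w s, 0 ≤ F w s := fun w s => mul_nonneg (hk0 _) (Real.exp_pos _).le
  let Ψ : C(Icc 0 L, ℝ) → ℝ → ℝ := fun w s => v₀ - ∫ t in (0 : ℝ)..s, runningMean (F w) t
  have hΨd : ∀ w s, HasDerivAt (Ψ w) (-runningMean (F w) s) s := fun w s => by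
    have := ((continuous_runningMean (hF w)).integral_hasStrictDerivAt 0 s).hasDerivAt
    simpa using this.const_sub v₀
  have hΨ : ∀ w, Continuous (Ψ w) := fun w =>
    continuous_iff_continuousAt.2 fun s => (hΨd w s).continuousAt
  let Φ : C(Icc 0 L, ℝ) → C(Icc 0 L, ℝ) := fun w =>
    ⟨fun s => Ψ w s, (hΨ w).comp continuous_subtype_val⟩
  obtain ⟨K₀, hK₀⟩ := isCompact_Icc.exists_bound_of_continuousOn (s := Icc 0 L) hk.continuousOn
  set K : ℝ := max K₀ 0 * Real.exp v₀
  have hK : 0 ≤ K := by positivity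
  have iter : ∀ (n : ℕ) (w₁ w₂ : C(Icc 0 L, ℝ)) (s : Icc 0 L),
      |(Φ^[n] w₁) s - (Φ^[n] w₂) s| ≤ (dist w₁ w₂ * (K ^ n / n.factorial)) * (s : ℝ) ^ n := by
    intro n w₁ w₂
    induction n with
    | zero =>
      intro s
      simpa [Real.dist_eq] using ContinuousMap.dist_apply_le_dist (f := w₁) (g := w₂) s
    | succ n ih =>
      intro s
      rw [Function.iterate_succ_apply', Function.iterate_succ_apply']
      have hb : ∀ t ∈ Icc 0 L, |F (Φ^[n] w₁) t - F (Φ^[n] w₂) t|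
          ≤ (K * (dist w₁ w₂ * (K ^ n / n.factorial))) * t ^ n := by
        intro t ht
        have e : projIcc 0 L hL t = ⟨t, ht⟩ := projIcc_of_mem hL ht
        have h1 := ih ⟨t, ht⟩
        have h2 := abs_exp_min_sub_le ((Φ^[n] w₁) ⟨t, ht⟩) ((Φ^[n] w₂) ⟨t, ht⟩) v₀
        have h3 : |k t| ≤ max K₀ 0 := (hK₀ t ht).trans (le_max_left _ _)
        simp only [F, e, ← mul_sub, abs_mul]
        calc |k t| * _ ≤ max K₀ 0 * (Real.exp v₀ * |(Φ^[n] w₁) ⟨t, ht⟩ - (Φ^[n] w₂) ⟨t, ht⟩|) := by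
              gcongr
          _ ≤ max K₀ 0 * (Real.exp v₀ * ((dist w₁ w₂ * (K ^ n / n.factorial)) * t ^ n)) := by
              gcongr
          _ = _ := by simp only [K]; ring
      have := abs_integral_runningMean_sub_le (hF _) (hF _) hb s.2
      have e : (Φ (Φ^[n] w₁)) s - (Φ (Φ^[n] w₂)) s
          = -((∫ t in (0 : ℝ)..s, runningMean (F (Φ^[n] w₁)) t)
            - ∫ t in (0 : ℝ)..s, runningMean (F (Φ^[n] w₂)) t) := by
        simp only [Φ, Ψ, ContinuousMap.coe_mk]; ring
      rw [e, abs_neg]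
      refine this.trans_eq ?_
      rw [Nat.factorial_succ]
      push_cast
      field_simp
      ring
  obtain ⟨n, hn⟩ : ∃ n : ℕ, (K * L) ^ n / n.factorial < 1 :=
    ((FloorSemiring.tendsto_pow_div_factorial_atTop (K * L)).eventually
      (gt_mem_nhds one_pos)).exists
  have hq : 0 ≤ (K * L) ^ n / n.factorial := by positivity
  have hcontr : ContractingWith ⟨(K * L) ^ n / n.factorial, hq⟩ Φ^[n] := by
    refine ⟨by exact_mod_cast hn, LipschitzWith.of_dist_le_mul fun w₁ w₂ => ?_⟩
    rw [ContinuousMap.dist_le (by positivity)]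
    intro s
    refine (iter n w₁ w₂ s).trans ?_
    have : (s : ℝ) ^ n ≤ L ^ n := pow_le_pow_left₀ s.2.1 s.2.2 n
    calc (dist w₁ w₂ * (K ^ n / n.factorial)) * (s : ℝ) ^ n
        ≤ (dist w₁ w₂ * (K ^ n / n.factorial)) * L ^ n := by gcongr
      _ = ((K * L) ^ n / n.factorial) * dist w₁ w₂ := by rw [mul_pow]; ring
      _ = _ := rfl
  have : Nonempty C(Icc 0 L, ℝ) := ⟨0⟩
  set w := ContractingWith.fixedPoint Φ^[n] hcontr
  have hw : Φ w = w := hcontr.isFixedPt_fixedPoint_iterate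
  have hwΨ : ∀ s (hs : s ∈ Icc 0 L), w ⟨s, hs⟩ = Ψ w s := fun s hs => by
    conv_lhs => rw [← hw]
    rfl
  refine ⟨Ψ w, runningMean (F w), F w, continuous_runningMean (hF w), hF w, by simp [Ψ],
    runningMean_zero _, hΨd w, hasDerivAt_mul_runningMean (hF w), fun s hs => ?_⟩
  have hle : Ψ w s ≤ v₀ := by
    have := intervalIntegral.integral_nonneg (μ := volume) hs.1
      fun t _ => runningMean_nonneg (hF0 w) t
    simp only [Ψ]; linarith
  simp only [F, projIcc_of_mem hL hs]
  rw [hwΨ s hs, min_eq_left hle]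

/-! ### Radial profiles and their mass -/

/-- `v` is a radial profile of the Liouville problem in the variable `s = r ^ (2 + 2α)`:
`v' = -g` and `(s g)' = f` on the line, where `f = c e ^ (κ + v)` on `[0, L]`. The quantity `s g s`
is, up to a factor, the mass enclosed in the circle with parameter `s`. -/
structure IsRadialProfile (c : ℝ) (κ : ℝ → ℝ) (L : ℝ) (v g f : ℝ → ℝ) : Prop where
  continuous_deriv : Continuous g
  continuous_density : Continuous f
  deriv_zero : g 0 = f 0
  hasDerivAt : ∀ s, HasDerivAt v (-g s) s
  hasDerivAt_mass : ∀ s, HasDerivAt (fun s => s * g s) (f s) s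
  density_eq : ∀ s ∈ Icc 0 L, f s = c * Real.exp (κ s + v s)

lemma exists_isRadialProfile {c : ℝ} (hc : 0 < c) {κ : ℝ → ℝ} (hκ : Continuous κ) {L : ℝ}
    (hL : 0 ≤ L) (v₀ : ℝ) : ∃ v g f : ℝ → ℝ, IsRadialProfile c κ L v g f ∧ v 0 = v₀ := by
  obtain ⟨v, g, f, hg, hf, h0, hgf, hv, hm, he⟩ := exists_radial_liouville
    (k := fun s => c * Real.exp (κ s)) (by fun_prop) (fun s => by positivity) hL v₀
  exact ⟨v, g, f, ⟨hg, hf, hgf, hv, hm, fun s hs => by rw [he s hs, Real.exp_add]; ring⟩, h0⟩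

namespace IsRadialProfile

variable {c L δ : ℝ} {κ κ' v g f : ℝ → ℝ}

lemma continuous (h : IsRadialProfile c κ L v g f) : Continuous v :=
  continuous_iff_continuousAt.2 fun s => (h.hasDerivAt s).continuousAt

lemma density_pos (h : IsRadialProfile c κ L v g f) (hc : 0 < c) {s : ℝ} (hs : s ∈ Icc 0 L) :
    0 < f s := by
  rw [h.density_eq s hs]; positivity

lemma mass_pos (h : IsRadialProfile c κ L v g f) (hc : 0 < c) {s : ℝ} (hs : s ∈ Ioc 0 L) :
    0 < s * g s := by
  have hmono : StrictMonoOn (fun s => s * g s) (Icc 0 L) := by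
    apply strictMonoOn_of_deriv_pos (convex_Icc 0 L)
    · exact fun s _ => (h.hasDerivAt_mass s).continuousAt.continuousWithinAt
    · intro s hs
      rw [interior_Icc] at hs
      rw [(h.hasDerivAt_mass s).deriv]
      exact h.density_pos hc ⟨hs.1.le, hs.2.le⟩
  simpa using hmono ⟨le_rfl, hs.1.le.trans hs.2⟩ ⟨hs.1.le, hs.2⟩ hs.1

lemma slope_pos (h : IsRadialProfile c κ L v g f) (hc : 0 < c) {s : ℝ} (hs : s ∈ Icc 0 L) :
    0 < g s := by
  rcases hs.1.eq_or_lt with rfl | h0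
  · rw [h.deriv_zero]; exact h.density_pos hc hs
  · exact pos_of_mul_pos_right (h.mass_pos hc ⟨h0, hs.2⟩) h0.le

/-- The first integral of the autonomous problem `κ = 0` is not conserved, but grows at the rate
`s κ' f`. -/
lemma hasDerivAt_firstIntegral (h : IsRadialProfile c κ L v g f) {s : ℝ} (hs : s ∈ Ioo 0 L)
    (hκ : HasDerivAt κ (κ' s) s) :
    HasDerivAt (fun s => s * f s - s * g s + (s * g s) ^ 2 / 2) (s * κ' s * f s) s := by
  have hf : HasDerivAt f (f s * (κ' s - g s)) s := by
    have h1 : HasDerivAt (fun s => c * Real.exp (κ s + v s))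
        (c * (Real.exp (κ s + v s) * (κ' s + -g s))) s :=
      ((hκ.add (h.hasDerivAt s)).exp).const_mul c
    have h2 : f =ᶠ[𝓝 s] fun s => c * Real.exp (κ s + v s) := by
      filter_upwards [Ioo_mem_nhds hs.1 hs.2] with t ht
      exact h.density_eq t ⟨ht.1.le, ht.2.le⟩
    refine (h1.congr_of_eventuallyEq h2).congr_deriv ?_
    rw [h.density_eq s ⟨hs.1.le, hs.2.le⟩]; ring
  have hm := h.hasDerivAt_mass s
  refine ((((hasDerivAt_id s).mul hf).sub hm).add ((hm.pow 2).div_const 2)).congr_deriv ?_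
  simp only [id]
  push_cast
  ring

/-- Along the flow the first integral stays between `0` and `δ` times the mass, when
`0 ≤ s κ' ≤ δ`. -/
lemma firstIntegral_mem_Icc (h : IsRadialProfile c κ L v g f) (hc : 0 < c)
    (hκ : ∀ s ∈ Ioo 0 L, HasDerivAt κ (κ' s) s) (hκ' : ∀ s ∈ Ioo 0 L, s * κ' s ∈ Icc 0 δ)
    {s : ℝ} (hs : s ∈ Icc 0 L) :
    s * f s - s * g s + (s * g s) ^ 2 / 2 ∈ Icc 0 (δ * (s * g s)) := by
  have hcf := h.continuous_density
  have hcg := h.continuous_deriv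
  have hcont : Continuous fun s => s * f s - s * g s + (s * g s) ^ 2 / 2 := by fun_prop
  have h0 : (0 : ℝ) ∈ Icc 0 L := ⟨le_rfl, hs.1.trans hs.2⟩
  constructor
  · have hmono : MonotoneOn (fun s => s * f s - s * g s + (s * g s) ^ 2 / 2) (Icc 0 L) := by
      apply monotoneOn_of_hasDerivWithinAt_nonneg (convex_Icc 0 L) hcont.continuousOn
        (f' := fun s => s * κ' s * f s)
      · intro t ht
        rw [interior_Icc] at ht ⊢
        exact (h.hasDerivAt_firstIntegral ht (hκ t ht)).hasDerivWithinAt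
      · intro t ht
        rw [interior_Icc] at ht
        exact mul_nonneg (hκ' t ht).1 (h.density_pos hc ⟨ht.1.le, ht.2.le⟩).le
    simpa using hmono h0 hs hs.1
  · have hmono : MonotoneOn (fun s => δ * (s * g s) - (s * f s - s * g s + (s * g s) ^ 2 / 2))
        (Icc 0 L) := by
      apply monotoneOn_of_hasDerivWithinAt_nonneg (convex_Icc 0 L)
        (by fun_prop) (f' := fun s => δ * f s - s * κ' s * f s)
      · intro t ht
        rw [interior_Icc] at ht ⊢
        exact (((h.hasDerivAt_mass t).const_mul δ).sub
          (h.hasDerivAt_firstIntegral ht (hκ t ht))).hasDerivWithinAt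
      · intro t ht
        rw [interior_Icc] at ht
        have := mul_le_mul_of_nonneg_right (hκ' t ht).2 (h.density_pos hc ⟨ht.1.le, ht.2.le⟩).le
        linarith
    have := hmono h0 hs hs.1
    simp only [zero_mul, mul_zero] at this
    linarith

lemma mass_le (h : IsRadialProfile c κ L v g f) (hc : 0 < c)
    (hκ : ∀ s ∈ Ioo 0 L, HasDerivAt κ (κ' s) s) (hκ' : ∀ s ∈ Ioo 0 L, s * κ' s ∈ Icc 0 δ)
    {s : ℝ} (hs : s ∈ Ioc 0 L) : s * g s ≤ 2 * (1 + δ) := by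
  have h1 := (h.firstIntegral_mem_Icc hc hκ hκ' ⟨hs.1.le, hs.2⟩).2
  have h2 := h.mass_pos hc hs
  have h3 := mul_pos hs.1 (h.density_pos hc ⟨hs.1.le, hs.2⟩)
  by_contra! h4
  nlinarith

/-- The density `s ↦ s f s` of the mass with respect to `ds / s` is bounded independently of the
initial value `v 0`. -/
lemma mul_density_le (h : IsRadialProfile c κ L v g f) (hc : 0 < c)
    (hκ : ∀ s ∈ Ioo 0 L, HasDerivAt κ (κ' s) s) (hκ' : ∀ s ∈ Ioo 0 L, s * κ' s ∈ Icc 0 δ)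
    {s : ℝ} (hs : s ∈ Ioc 0 L) : s * f s ≤ (1 + δ) ^ 2 / 2 := by
  have h1 := (h.firstIntegral_mem_Icc hc hκ hκ' ⟨hs.1.le, hs.2⟩).2
  nlinarith [sq_nonneg (s * g s - (1 + δ))]

/-- Lower bound for the mass: `2 / g s - s` decreases, as it would be constant in the autonomous
case, and its value at the origin tends to zero as `v 0 → ∞`. -/
lemma two_sub_mass_le (h : IsRadialProfile c κ L v g f) (hc : 0 < c)
    (hκ : ∀ s ∈ Ioo 0 L, HasDerivAt κ (κ' s) s) (hκ' : ∀ s ∈ Ioo 0 L, s * κ' s ∈ Icc 0 δ)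
    {s : ℝ} (hs : s ∈ Ioc 0 L) : 2 - s * g s ≤ 2 / f 0 * g s := by
  have hcg := h.continuous_deriv
  have hanti : AntitoneOn (fun s => 2 / g s - s) (Icc 0 L) := by
    apply antitoneOn_of_hasDerivWithinAt_nonpos (convex_Icc 0 L)
      (f' := fun s => -2 * ((f s - g s) / s) / g s ^ 2 - 1)
    · exact (continuousOn_const.div hcg.continuousOn
        fun t ht => (h.slope_pos hc ht).ne').sub continuousOn_id
    · intro t ht
      rw [interior_Icc] at ht ⊢
      have hgt := h.slope_pos hc ⟨ht.1.le, ht.2.le⟩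
      have hg : HasDerivAt g ((f t - g t) / t) t := by
        have h1 := (h.hasDerivAt_mass t).div (hasDerivAt_id t) ht.1.ne'
        have h2 : g =ᶠ[𝓝 t] fun s => s * g s / id s := by
          filter_upwards [lt_mem_nhds ht.1] with r hr
          simp only [id]; field_simp
        refine (h1.congr_of_eventuallyEq h2).congr_deriv ?_
        have := ht.1.ne'
        simp only [id]; field_simp
      refine HasDerivAt.hasDerivWithinAt ?_
      refine (((hasDerivAt_const t (2 : ℝ)).div hg hgt.ne').sub (hasDerivAt_id t)).congr_deriv ?_
      ring
    · intro t ht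
      rw [interior_Icc] at ht
      have hgt := h.slope_pos hc ⟨ht.1.le, ht.2.le⟩
      have h1 := (h.firstIntegral_mem_Icc hc hκ hκ' ⟨ht.1.le, ht.2.le⟩).1
      have h0 := ht.1
      rw [sub_nonpos, div_le_one (by positivity), ← mul_div_assoc, div_le_iff₀ h0]
      have h2 : 0 ≤ t * (2 * f t - 2 * g t + t * g t ^ 2) := by linarith
      have h3 := nonneg_of_mul_nonneg_right h2 h0
      linarith
  have h1 := hanti ⟨le_rfl, hs.1.le.trans hs.2⟩ ⟨hs.1.le, hs.2⟩ hs.1.le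
  have hgs := h.slope_pos hc ⟨hs.1.le, hs.2⟩
  simp only [sub_zero, h.deriv_zero] at h1
  have h2 := mul_le_mul_of_nonneg_right h1 hgs.le
  rw [sub_mul, div_mul_cancel₀ _ hgs.ne'] at h2
  exact h2

/-- In the variable `log s` the profile is Lipschitz, since its logarithmic derivative is minus the
mass. If the mass is close to `2` then `v` is close to `-2 log s` up to a constant. -/
lemma abs_add_mul_log_sub_le (h : IsRadialProfile c κ L v g f) {a b A K : ℝ} (ha : 0 < a)
    (hm : ∀ s ∈ Icc a b, |s * g s - A| ≤ K) {s t : ℝ} (hs : s ∈ Icc a b) (ht : t ∈ Icc a b) :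
    |(v s + A * Real.log s) - (v t + A * Real.log t)| ≤ K * |Real.log s - Real.log t| := by
  have hd : ∀ x ∈ Icc (Real.log a) (Real.log b),
      HasDerivWithinAt (fun x => v (Real.exp x) + A * x) (A - Real.exp x * g (Real.exp x))
        (Icc (Real.log a) (Real.log b)) x := by
    intro x _
    have := ((h.hasDerivAt (Real.exp x)).comp x (Real.hasDerivAt_exp x)).add
      ((hasDerivAt_id x).const_mul A)
    refine HasDerivAt.hasDerivWithinAt (this.congr_deriv ?_)
    ring
  have hb : 0 < b := ha.trans_le (hs.1.trans hs.2)
  have hlog : ∀ x ∈ Icc a b, Real.log x ∈ Icc (Real.log a) (Real.log b) := fun x hx =>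
    ⟨Real.log_le_log ha hx.1, Real.log_le_log (ha.trans_le hx.1) hx.2⟩
  have := (convex_Icc (Real.log a) (Real.log b)).norm_image_sub_le_of_norm_hasDerivWithin_le
    (C := K) hd (fun x hx => ?_) (hlog t ht) (hlog s hs)
  · rw [Real.exp_log (ha.trans_le hs.1), Real.exp_log (ha.trans_le ht.1)] at this
    exact this
  · rw [Real.norm_eq_abs, abs_sub_comm]
    apply hm
    constructor
    · rw [← Real.log_le_iff_le_exp ha]; exact hx.1
    · rw [← Real.le_log_iff_exp_le hb]; exact hx.2

end IsRadialProfile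

/-! ### Conformal pull-back of radial solutions -/

lemma ContDiffAt.differentiableAt_fderiv_apply {f : ℂ → ℝ} {x : ℂ} (hf : ContDiffAt ℝ 2 f x)
    (e : ℂ) : DifferentiableAt ℝ (fun y => fderiv ℝ f y e) x :=
  ((hf.fderiv_right (m := 1) (by norm_num)).differentiableAt one_ne_zero).clm_apply
    (differentiableAt_const e)

/-- The Laplacian in the plane as a sum of two iterated directional derivatives. -/
lemma ContDiffAt.laplacian_eq_fderiv_fderiv {f : ℂ → ℝ} {x : ℂ} (hf : ContDiffAt ℝ 2 f x) :
    Laplacian.laplacian f x = fderiv ℝ (fun y => fderiv ℝ f y 1) x 1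
      + fderiv ℝ (fun y => fderiv ℝ f y Complex.I) x Complex.I := by
  have hd : DifferentiableAt ℝ (fderiv ℝ f) x :=
    (hf.fderiv_right (m := 1) (by norm_num)).differentiableAt one_ne_zero
  have key : ∀ e : ℂ, fderiv ℝ (fun y => fderiv ℝ f y e) x e = fderiv ℝ (fderiv ℝ f) x e e := by
    intro e
    rw [fderiv_clm_apply hd (differentiableAt_const e)]
    simp
  rw [laplacian_eq_iteratedFDeriv_complexPlane, key, key]
  simp [iteratedFDeriv_two_apply]

/-- Chain rule for the Laplacian of `G ∘ ℓ`. -/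
lemma ContDiffAt.laplacian_comp {G : ℝ → ℝ} (hG : ContDiff ℝ 2 G) {ℓ : ℂ → ℝ} {x : ℂ}
    (hℓ : ContDiffAt ℝ 2 ℓ x) :
    Laplacian.laplacian (fun y => G (ℓ y)) x
      = deriv (deriv G) (ℓ x) * (fderiv ℝ ℓ x 1 ^ 2 + fderiv ℝ ℓ x Complex.I ^ 2)
        + deriv G (ℓ x) * Laplacian.laplacian ℓ x := by
  have hG' : ∀ t, HasDerivAt G (deriv G t) t := fun t =>
    (hG.differentiable two_ne_zero t).hasDerivAt
  have hG'' : ∀ t, HasDerivAt (deriv G) (deriv (deriv G) t) t := fun t =>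
    ((contDiff_succ_iff_deriv (n := 1).1 hG).2.2.differentiable one_ne_zero t).hasDerivAt
  have hev : ∀ᶠ y in 𝓝 x, ContDiffAt ℝ 2 ℓ y := hℓ.eventually (by simp)
  have key : ∀ e : ℂ, fderiv ℝ (fun y => fderiv ℝ (fun y => G (ℓ y)) y e) x e
      = deriv (deriv G) (ℓ x) * fderiv ℝ ℓ x e ^ 2
        + deriv G (ℓ x) * fderiv ℝ (fun y => fderiv ℝ ℓ y e) x e := by
    intro e
    have h1 : (fun y => fderiv ℝ (fun y => G (ℓ y)) y e)
        =ᶠ[𝓝 x] fun y => deriv G (ℓ y) * fderiv ℝ ℓ y e := by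
      filter_upwards [hev] with y hy
      have hd := (hy.differentiableAt two_ne_zero).hasFDerivAt
      have h3 : HasFDerivAt (fun y => G (ℓ y)) _ y := (hG' (ℓ y)).comp_hasFDerivAt y hd
      rw [h3.fderiv]
      simp
    rw [h1.fderiv_eq]
    have hd := (hℓ.differentiableAt two_ne_zero).hasFDerivAt
    have h2 : HasFDerivAt (fun y => deriv G (ℓ y)) _ x := (hG'' (ℓ x)).comp_hasFDerivAt x hd
    have h3 : HasFDerivAt (fun y => deriv G (ℓ y) * fderiv ℝ ℓ y e) _ x :=
      h2.mul (hℓ.differentiableAt_fderiv_apply e).hasFDerivAt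
    rw [h3.fderiv]
    simp
    ring
  have hc : ContDiffAt ℝ 2 (fun y => G (ℓ y)) x := hG.contDiffAt.comp x hℓ
  rw [hc.laplacian_eq_fderiv_fderiv, hℓ.laplacian_eq_fderiv_fderiv, key, key]
  ring

lemma harmonicAt_log_norm_id {x : ℂ} (hx : x ≠ 0) : HarmonicAt (fun y : ℂ => Real.log ‖y‖) x :=
  AnalyticAt.harmonicAt_log_norm (f := fun y => y) analyticAt_id hx

lemma harmonicAt_const_mul_re (β : ℝ) (x : ℂ) : HarmonicAt (fun y : ℂ => β * y.re) x :=
  (AnalyticAt.harmonicAt_re (f := fun y => y) analyticAt_id).const_smul (c := β)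

lemma hasFDerivAt_log_norm {x : ℂ} (hx : x ≠ 0) :
    HasFDerivAt (fun y : ℂ => Real.log ‖y‖) ((‖x‖ ^ 2)⁻¹ • innerSL ℝ x) x := by
  have h0 : ‖x‖ ^ 2 ≠ 0 := pow_ne_zero 2 (norm_ne_zero_iff.2 hx)
  have h1 := (((hasStrictFDerivAt_norm_sq x).hasFDerivAt).log h0).const_mul (1 / 2 : ℝ)
  have h2 : (fun y : ℂ => Real.log ‖y‖) = fun y : ℂ => 1 / 2 * Real.log (‖y‖ ^ 2) := by
    ext y; rw [Real.log_pow]; push_cast; ring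
  rw [h2]
  refine h1.congr_fderiv ?_
  ext e
  simp
  ring

/-- The conformal factor of the map `z ↦ z e ^ (β z)` in logarithmic coordinates. -/
lemma normSq_fderiv_log_norm_add {β : ℝ} {x : ℂ} (hx : x ≠ 0) :
    fderiv ℝ (fun y : ℂ => Real.log ‖y‖ + β * y.re) x 1 ^ 2
      + fderiv ℝ (fun y : ℂ => Real.log ‖y‖ + β * y.re) x Complex.I ^ 2
      = ‖1 + β * x‖ ^ 2 / ‖x‖ ^ 2 := by
  have h : HasFDerivAt (fun y : ℂ => Real.log ‖y‖ + β * y.re) _ x :=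
    (hasFDerivAt_log_norm hx).add (Complex.reCLM.hasFDerivAt.const_mul β)
  have h0 : ‖x‖ ^ 2 ≠ 0 := pow_ne_zero 2 (norm_ne_zero_iff.2 hx)
  rw [h.fderiv]
  simp [Complex.inner]
  have e1 : ‖x‖ ^ 2 = x.re ^ 2 + x.im ^ 2 := by
    rw [Complex.sq_norm, Complex.normSq_apply]; ring
  have e2 : ‖1 + β * x‖ ^ 2 = (1 + β * x.re) ^ 2 + (β * x.im) ^ 2 := by
    rw [Complex.sq_norm, Complex.normSq_apply]; simp; ring
  rw [e2]
  field_simp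
  rw [e1]
  ring

namespace IsRadialProfile

variable {c L : ℝ} {κ v g f : ℝ → ℝ}

lemma hasDerivAt_comp_exp (h : IsRadialProfile c κ L v g f) (p t : ℝ) :
    HasDerivAt (fun t => v (Real.exp (p * t))) (-p * (Real.exp (p * t) * g (Real.exp (p * t)))) t
      := by
  have he : HasDerivAt (fun t => Real.exp (p * t)) (Real.exp (p * t) * p) t := by
    simpa using ((hasDerivAt_id t).const_mul p).exp
  refine ((h.hasDerivAt _).comp t he).congr_deriv ?_
  ring

lemma hasDerivAt_deriv_comp_exp (h : IsRadialProfile c κ L v g f) (p t : ℝ) :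
    HasDerivAt (fun t => -p * (Real.exp (p * t) * g (Real.exp (p * t))))
      (-p ^ 2 * Real.exp (p * t) * f (Real.exp (p * t))) t := by
  have he : HasDerivAt (fun t => Real.exp (p * t)) (Real.exp (p * t) * p) t := by
    simpa using ((hasDerivAt_id t).const_mul p).exp
  refine (((h.hasDerivAt_mass _).comp t he).const_mul (-p)).congr_deriv ?_
  ring

lemma contDiff_comp_exp (h : IsRadialProfile c κ L v g f) (p : ℝ) :
    ContDiff ℝ 2 fun t => v (Real.exp (p * t)) := by
  have hd : deriv (fun t => v (Real.exp (p * t)))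
      = fun t => -p * (Real.exp (p * t) * g (Real.exp (p * t))) :=
    funext fun t => (h.hasDerivAt_comp_exp p t).deriv
  have hdd : deriv (fun t => -p * (Real.exp (p * t) * g (Real.exp (p * t))))
      = fun t => -p ^ 2 * Real.exp (p * t) * f (Real.exp (p * t)) :=
    funext fun t => (h.hasDerivAt_deriv_comp_exp p t).deriv
  rw [show (2 : WithTop ℕ∞) = 1 + 1 by norm_num, contDiff_succ_iff_deriv]
  refine ⟨fun t => (h.hasDerivAt_comp_exp p t).differentiableAt, by simp, ?_⟩
  rw [hd, contDiff_one_iff_deriv]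
  refine ⟨fun t => (h.hasDerivAt_deriv_comp_exp p t).differentiableAt, ?_⟩
  rw [hdd]
  have := h.continuous_density
  fun_prop

end IsRadialProfile

/-- `|z e ^ (β z)| ^ p`: the radial variable after the conformal change of coordinates
`z ↦ z e ^ (β z)`. -/
noncomputable def conformalRadius (p β : ℝ) (z : ℂ) : ℝ := ‖z‖ ^ p * Real.exp (p * β * z.re)

/-- The harmonic function `log |H'| ^ 2 + (p - 2) log |H / z|` for `H z = z e ^ (β z)`, by which
the pull-back of a radial solution along `H` has to be corrected. -/
noncomputable def conformalCorrection (p β : ℝ) (z : ℂ) : ℝ :=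
  2 * Real.log ‖1 + β * z‖ + p * β * z.re

/-- The pull-back of the radial profile `v` along `z ↦ z e ^ (β z)`. -/
noncomputable def pulledBack (p β : ℝ) (v : ℝ → ℝ) (z : ℂ) : ℝ :=
  v (conformalRadius p β z) + conformalCorrection p β z

/-- The coefficient `exp (b |H| ^ 2)` with `H z = z e ^ (β z)`. -/
noncomputable def expCoefficient (b β : ℝ) (z : ℂ) : ℝ :=
  Real.exp (b * (‖z‖ ^ 2 * Real.exp (2 * β * z.re)))

lemma conformalRadius_eq_exp (p β : ℝ) {z : ℂ} (hz : z ≠ 0) :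
    conformalRadius p β z = Real.exp (p * (Real.log ‖z‖ + β * z.re)) := by
  rw [conformalRadius, Real.rpow_def_of_pos (norm_pos_iff.2 hz), ← Real.exp_add]
  ring_nf

lemma conformalRadius_nonneg (p β : ℝ) (z : ℂ) : 0 ≤ conformalRadius p β z := by
  unfold conformalRadius; positivity

lemma continuous_conformalRadius {p : ℝ} (hp : 0 ≤ p) (β : ℝ) :
    Continuous (conformalRadius p β) := by
  unfold conformalRadius
  have : Continuous fun z : ℂ => ‖z‖ ^ p := continuous_norm.rpow_const fun _ => Or.inr hp
  have := Complex.continuous_re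
  fun_prop

lemma conformalRadius_rpow {p : ℝ} (hp : 0 < p) (β : ℝ) (z : ℂ) :
    conformalRadius p β z ^ (2 / p) = ‖z‖ ^ 2 * Real.exp (2 * β * z.re) := by
  rw [conformalRadius, Real.mul_rpow (by positivity) (Real.exp_pos _).le,
    ← Real.rpow_mul (norm_nonneg z), ← Real.exp_mul, mul_div_cancel₀ _ hp.ne', Real.rpow_two]
  congr 2
  field_simp

lemma harmonicAt_log_norm_add (β : ℝ) {z : ℂ} (hz : z ≠ 0) :
    HarmonicAt (fun y : ℂ => Real.log ‖y‖ + β * y.re) z :=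
  (harmonicAt_log_norm_id hz).add (harmonicAt_const_mul_re β z)

lemma harmonicAt_conformalCorrection (p β : ℝ) {z : ℂ} (hz : 1 + β * z ≠ 0) :
    HarmonicAt (conformalCorrection p β) z :=
  ((AnalyticAt.harmonicAt_log_norm (f := fun y => 1 + β * y) (by fun_prop) hz).const_smul
    (c := 2)).add (harmonicAt_const_mul_re (p * β) z)

section

variable {p β b L : ℝ} {v g f : ℝ → ℝ}

lemma pulledBack_eventuallyEq {z : ℂ} (hz : z ≠ 0) :
    pulledBack p β v =ᶠ[𝓝 z] (fun y => (fun t => v (Real.exp (p * t))) (Real.log ‖y‖ + β * y.re))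
      + conformalCorrection p β := by
  filter_upwards [isOpen_ne.mem_nhds hz] with y hy
  simp [pulledBack, conformalRadius_eq_exp p β hy]

lemma contDiffAt_pulledBack {c : ℝ} {κ : ℝ → ℝ} (h : IsRadialProfile c κ L v g f) {z : ℂ}
    (hz : z ≠ 0) (hz' : 1 + β * z ≠ 0) : ContDiffAt ℝ 2 (pulledBack p β v) z :=
  (((h.contDiff_comp_exp p).contDiffAt.comp z (harmonicAt_log_norm_add β hz).1).add
    (harmonicAt_conformalCorrection p β hz').1).congr_of_eventuallyEq (pulledBack_eventuallyEq hz)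

/-- The Liouville equation is conformally covariant: pulling back a radial solution with
coefficient `exp (b r ^ 2)` gives a solution with the pulled back coefficient. -/
lemma laplacian_pulledBack (hp : 0 < p)
    (h : IsRadialProfile ((p ^ 2)⁻¹) (fun s => b * s ^ (2 / p)) L v g f) {z : ℂ}
    (hz : z ≠ 0) (hz' : 1 + β * z ≠ 0) (hL : conformalRadius p β z ≤ L) :
    Laplacian.laplacian (pulledBack p β v) z
      + ‖z‖ ^ (p - 2) * expCoefficient b β z * Real.exp (pulledBack p β v z) = 0 := by
  have hℓ := harmonicAt_log_norm_add β hz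
  have hq := harmonicAt_conformalCorrection p β hz'
  have hG := h.contDiff_comp_exp p
  have hn : 0 < ‖z‖ := norm_pos_iff.2 hz
  have hn' : 0 < ‖1 + β * z‖ := norm_pos_iff.2 hz'
  have hd : deriv (fun t => v (Real.exp (p * t)))
      = fun t => -p * (Real.exp (p * t) * g (Real.exp (p * t))) :=
    funext fun t => (h.hasDerivAt_comp_exp p t).deriv
  have hc : ContDiffAt ℝ 2 (fun y : ℂ => (fun t => v (Real.exp (p * t)))
      (Real.log ‖y‖ + β * y.re)) z := hG.contDiffAt.comp z hℓ.1
  rw [(laplacian_congr_nhds (pulledBack_eventuallyEq hz)).eq_of_nhds, hc.laplacian_add hq.1,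
    hℓ.1.laplacian_comp hG, hℓ.2.eq_of_nhds, hq.2.eq_of_nhds, normSq_fderiv_log_norm_add hz, hd,
    (h.hasDerivAt_deriv_comp_exp p _).deriv, ← conformalRadius_eq_exp p β hz,
    h.density_eq _ ⟨conformalRadius_nonneg p β z, hL⟩, conformalRadius_rpow hp, expCoefficient,
    pulledBack, conformalCorrection]
  simp only [Pi.zero_apply, mul_zero, add_zero, Real.exp_add]
  rw [show 2 * Real.log ‖1 + β * z‖ = Real.log (‖1 + β * z‖ ^ 2) by rw [Real.log_pow]; norm_num,
    Real.exp_log (by positivity), Real.rpow_sub hn, Real.rpow_two]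
  generalize hs : v (conformalRadius p β z) = V
  rw [conformalRadius]
  field_simp
  ring

end

/-! ### Weak formulation and removability of points -/

lemma integrable_mul_of_continuousAt_tsupport {a b : ℂ → ℝ} (hb : Continuous b)
    (hc : HasCompactSupport b) (ha : ∀ x ∈ tsupport b, ContinuousAt a x) :
    Integrable fun x => a x * b x := by
  refine Continuous.integrable_of_hasCompactSupport ?_ hc.mul_left
  exact continuous_of_tsupport fun x hx =>
    (ha x (tsupport_mul_subset_right hx)).mul hb.continuousAt

lemma ContDiffAt.continuousAt_fderiv_fderiv {u : ℂ → ℝ} {x : ℂ} (hu : ContDiffAt ℝ 2 u x) (e : ℂ) :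
    ContinuousAt (fun y => fderiv ℝ (fun y => fderiv ℝ u y e) y e) x := by
  have h1 : ContDiffAt ℝ 1 (fun y => fderiv ℝ u y e) x :=
    (hu.fderiv_right (m := 1) (by norm_num)).clm_apply contDiffAt_const
  exact ((h1.fderiv_right (m := 0) (by norm_num)).continuousAt).clm_apply continuousAt_const

lemma ContDiff.contDiff_fderiv_const_apply {φ : ℂ → ℝ} (hφ : ContDiff ℝ ∞ φ) (e : ℂ) :
    ContDiff ℝ ∞ fun y => fderiv ℝ φ y e :=
  (hφ.fderiv_right (m := ∞) (by simp)).clm_apply contDiff_const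

/-- **Green's second identity** for a test function. -/
lemma integral_mul_laplacian_eq {u φ : ℂ → ℝ} (hφ : ContDiff ℝ ∞ φ) (hc : HasCompactSupport φ)
    (hu : ∀ x ∈ tsupport φ, ContDiffAt ℝ 2 u x) :
    ∫ x, u x * Laplacian.laplacian φ x = ∫ x, Laplacian.laplacian u x * φ x := by
  have dir : ∀ e : ℂ, Integrable (fun x => u x * fderiv ℝ (fun y => fderiv ℝ φ y e) x e) ∧
      Integrable (fun x => fderiv ℝ (fun y => fderiv ℝ u y e) x e * φ x) ∧
      ∫ x, u x * fderiv ℝ (fun y => fderiv ℝ φ y e) x e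
        = ∫ x, fderiv ℝ (fun y => fderiv ℝ u y e) x e * φ x := by
    intro e
    have hφ1 := hφ.contDiff_fderiv_const_apply e
    have hφ2 := hφ1.contDiff_fderiv_const_apply e
    have hs1 : tsupport (fun y => fderiv ℝ φ y e) ⊆ tsupport φ := tsupport_fderiv_apply_subset ℝ e
    have hs2 : tsupport (fun y => fderiv ℝ (fun y => fderiv ℝ φ y e) y e) ⊆ tsupport φ :=
      (tsupport_fderiv_apply_subset ℝ e).trans hs1
    have hc1 : HasCompactSupport fun y => fderiv ℝ φ y e := hc.fderiv_apply ℝ e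
    have hc2 : HasCompactSupport fun y => fderiv ℝ (fun y => fderiv ℝ φ y e) y e :=
      hc1.fderiv_apply ℝ e
    have i1 : Integrable fun x => fderiv ℝ u x e * fderiv ℝ φ x e :=
      integrable_mul_of_continuousAt_tsupport hφ1.continuous hc1 fun x hx =>
        ((hu x (hs1 hx)).differentiableAt_fderiv_apply e).continuousAt
    have i2 : Integrable fun x => u x * fderiv ℝ (fun y => fderiv ℝ φ y e) x e :=
      integrable_mul_of_continuousAt_tsupport hφ2.continuous hc2 fun x hx =>
        (hu x (hs2 hx)).continuousAt
    have i3 : Integrable fun x => u x * fderiv ℝ φ x e :=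
      integrable_mul_of_continuousAt_tsupport hφ1.continuous hc1 fun x hx =>
        (hu x (hs1 hx)).continuousAt
    have i4 : Integrable fun x => fderiv ℝ (fun y => fderiv ℝ u y e) x e * φ x :=
      integrable_mul_of_continuousAt_tsupport hφ.continuous hc fun x hx =>
        (hu x hx).continuousAt_fderiv_fderiv e
    have i5 : Integrable fun x => fderiv ℝ u x e * φ x :=
      integrable_mul_of_continuousAt_tsupport hφ.continuous hc fun x hx =>
        ((hu x hx).differentiableAt_fderiv_apply e).continuousAt
    refine ⟨i2, i4, ?_⟩
    have e1 := integral_mul_fderiv_eq_neg_fderiv_mul_of_integrable (μ := volume) (f := u)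
      (g := fun y => fderiv ℝ φ y e) (v := e) i1 i2 i3
      (fun x hx => (hu x (hs1 hx)).differentiableAt two_ne_zero)
      (fun x _ => hφ1.differentiable (by simp) x)
    have e2 := integral_mul_fderiv_eq_neg_fderiv_mul_of_integrable (μ := volume)
      (f := fun y => fderiv ℝ u y e) (g := φ) (v := e) i4 i1 i5
      (fun x hx => (hu x hx).differentiableAt_fderiv_apply e)
      (fun x _ => hφ.differentiable (by simp) x)
    rw [e1, e2, neg_neg]
  have hφ' : ∀ x, ContDiffAt ℝ 2 φ x := fun x => (hφ.of_le ENat.LEInfty.out).contDiffAt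
  obtain ⟨a1, a2, a3⟩ := dir 1
  obtain ⟨b1, b2, b3⟩ := dir Complex.I
  calc ∫ x, u x * Laplacian.laplacian φ x
      = ∫ x, (u x * fderiv ℝ (fun y => fderiv ℝ φ y 1) x 1
          + u x * fderiv ℝ (fun y => fderiv ℝ φ y Complex.I) x Complex.I) := by
        congr 1; ext x; rw [(hφ' x).laplacian_eq_fderiv_fderiv]; ring
    _ = ∫ x, (fderiv ℝ (fun y => fderiv ℝ u y 1) x 1 * φ x
          + fderiv ℝ (fun y => fderiv ℝ u y Complex.I) x Complex.I * φ x) := by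
        rw [integral_add a1 b1, integral_add a2 b2, a3, b3]
    _ = _ := by
        congr 1; ext x
        by_cases hx : x ∈ tsupport φ
        · rw [(hu x hx).laplacian_eq_fderiv_fderiv]; ring
        · simp [image_eq_zero_of_notMem_tsupport hx]

lemma abs_laplacian_le (φ : ℂ → ℝ) (x : ℂ) :
    |Laplacian.laplacian φ x| ≤ 2 * ‖iteratedFDeriv ℝ 2 φ x‖ := by
  rw [laplacian_eq_iteratedFDeriv_complexPlane]
  have key : ∀ e : ℂ, ‖e‖ = 1 → ‖iteratedFDeriv ℝ 2 φ x ![e, e]‖ ≤ ‖iteratedFDeriv ℝ 2 φ x‖ := by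
    intro e he
    simpa [he] using (iteratedFDeriv ℝ 2 φ x).le_opNorm ![e, e]
  rw [two_mul]
  exact (abs_add_le _ _).trans (add_le_add (key 1 (by simp)) (key Complex.I (by simp)))

lemma exists_norm_iteratedFDeriv_le {φ : ℂ → ℝ} (hφ : ContDiff ℝ ∞ φ) (hc : HasCompactSupport φ) :
    ∃ C : ℝ, 0 ≤ C ∧ ∀ i ≤ 2, ∀ x, ‖iteratedFDeriv ℝ i φ x‖ ≤ C := by
  have : ∀ i : ℕ, ∃ C : ℝ, ∀ x, ‖iteratedFDeriv ℝ i φ x‖ ≤ C := fun i =>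
    (hc.iteratedFDeriv i).exists_bound_of_continuous
      (hφ.continuous_iteratedFDeriv (m := i) (by exact_mod_cast le_top))
  choose C hC using this
  refine ⟨max (max (C 0) (C 1)) (max (C 2) 0), by simp, fun i hi x => (hC i x).trans ?_⟩
  interval_cases i <;> simp

/-- Cutting a test function off to the disc of radius `2 ε` costs a factor `ε⁻²` in its
Laplacian. -/
lemma exists_abs_laplacian_mul_cutoff_le {φ η : ℂ → ℝ} (hφ : ContDiff ℝ ∞ φ)
    (hφc : HasCompactSupport φ) (hη : ContDiff ℝ ∞ η) (hηc : HasCompactSupport η) :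
    ∃ C : ℝ, 0 ≤ C ∧ ∀ ε ∈ Ioo (0 : ℝ) 1, ∀ x,
      |Laplacian.laplacian (fun y => φ y * η (ε⁻¹ • y)) x| ≤ C / ε ^ 2 := by
  obtain ⟨A, hA0, hA⟩ := exists_norm_iteratedFDeriv_le hφ hφc
  obtain ⟨B, hB0, hB⟩ := exists_norm_iteratedFDeriv_le hη hηc
  refine ⟨8 * A * B, by positivity, fun ε hε x => ?_⟩
  have hε' : 1 ≤ ε⁻¹ := (one_le_inv₀ hε.1).2 hε.2.le
  have hs : ContDiff ℝ ∞ fun y => η (ε⁻¹ • y) := hη.comp (contDiff_const_smul _)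
  have hs' : ∀ i ≤ 2, ‖iteratedFDeriv ℝ i (fun y => η (ε⁻¹ • y)) x‖ ≤ (ε⁻¹) ^ 2 * B := by
    intro i hi
    rw [iteratedFDeriv_comp_const_smul _ (hη.of_le (by exact_mod_cast le_top)), norm_smul,
      norm_pow, Real.norm_of_nonneg (by positivity)]
    exact mul_le_mul (pow_le_pow_right₀ hε' hi) (hB i hi _) (norm_nonneg _) (by positivity)
  have h1 := norm_iteratedFDeriv_mul_le hφ hs x (n := 2) ENat.LEInfty.out
  have h2 : ‖iteratedFDeriv ℝ 2 (fun y => φ y * η (ε⁻¹ • y)) x‖ ≤ 4 * A * ((ε⁻¹) ^ 2 * B) := by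
    refine h1.trans ?_
    calc _ ≤ ∑ i ∈ Finset.range 3, (Nat.choose 2 i : ℝ) * A * ((ε⁻¹) ^ 2 * B) := by
          apply Finset.sum_le_sum
          intro i hi
          have hi : i ≤ 2 := by simpa [Nat.lt_succ_iff] using hi
          gcongr
          · exact hA i hi x
          · exact hs' _ (Nat.sub_le _ _)
      _ = _ := by
          simp [Finset.sum_range_succ]
          ring
  refine (abs_laplacian_le _ x).trans ?_
  calc 2 * _ ≤ 2 * (4 * A * ((ε⁻¹) ^ 2 * B)) := by gcongr
    _ = _ := by field_simp; ring

lemma laplacian_zero_of_notMem_tsupport {φ : ℂ → ℝ} {x : ℂ} (hx : x ∉ tsupport φ) :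
    Laplacian.laplacian φ x = 0 := by
  have : φ =ᶠ[𝓝 x] fun _ => (0 : ℝ) := by
    filter_upwards [(isClosed_tsupport φ).isOpen_compl.mem_nhds hx] with y hy
    exact image_eq_zero_of_notMem_tsupport hy
  rw [(laplacian_congr_nhds this).eq_of_nhds, laplacian_const]; rfl

lemma continuous_laplacian {φ : ℂ → ℝ} (hφ : ContDiff ℝ ∞ φ) :
    Continuous (Laplacian.laplacian φ) := by
  rw [laplacian_eq_iteratedFDeriv_complexPlane]
  have := hφ.continuous_iteratedFDeriv (m := 2) ENat.LEInfty.out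
  fun_prop

lemma tsupport_laplacian_subset (φ : ℂ → ℝ) : tsupport (Laplacian.laplacian φ) ⊆ tsupport φ :=
  closure_minimal (fun _ hx => by_contra fun h => hx (laplacian_zero_of_notMem_tsupport h))
    (isClosed_tsupport φ)

lemma hasCompactSupport_laplacian {φ : ℂ → ℝ} (hφ : HasCompactSupport φ) :
    HasCompactSupport (Laplacian.laplacian φ) :=
  hφ.of_isClosed_subset (isClosed_tsupport _) (tsupport_laplacian_subset φ)

lemma integral_laplacian_eq_zero {φ : ℂ → ℝ} (hφ : ContDiff ℝ ∞ φ) (hc : HasCompactSupport φ) :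
    ∫ x, Laplacian.laplacian φ x = 0 := by
  simpa using integral_mul_laplacian_eq (u := fun _ => (1 : ℝ)) hφ hc fun _ _ => contDiffAt_const

/-- A continuous function that solves `Δ u + F = 0` classically in the punctured open set
`U \ {0}`, with `F` integrable against the test function, solves it in the sense of distributions
in `U`: points are removable. In the contribution of the disc of radius `2 ε`, the factor `ε⁻²` from
the cut-off is compensated by the area of the disc, and `u - u 0` is small there. -/
lemma integral_mul_laplacian_add_eq_zero {U : Set ℂ} {u F : ℂ → ℝ}
    (hu0 : ∀ x ∈ U, ContinuousAt u x) (h0U : (0 : ℂ) ∈ U)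
    (hu : ∀ x ∈ U, x ≠ 0 → ContDiffAt ℝ 2 u x)
    (heq : ∀ x ∈ U, x ≠ 0 → Laplacian.laplacian u x + F x = 0) {φ : ℂ → ℝ}
    (hφ : ContDiff ℝ ∞ φ) (hc : HasCompactSupport φ) (hφU : tsupport φ ⊆ U)
    (hF : Integrable fun x => F x * φ x) :
    (∫ x, u x * Laplacian.laplacian φ x) + ∫ x, F x * φ x = 0 := by
  let η : ContDiffBump (0 : ℂ) := ⟨1, 2, one_pos, one_lt_two⟩
  have hη : ContDiff ℝ ∞ η := η.contDiff
  obtain ⟨C, hC0, hC⟩ := exists_abs_laplacian_mul_cutoff_le hφ hc hη η.hasCompactSupport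
  set A := (∫ x, u x * Laplacian.laplacian φ x) + ∫ x, F x * φ x
  let inner : ℝ → ℂ → ℝ := fun ε y => φ y * η (ε⁻¹ • y)
  let outer : ℝ → ℂ → ℝ := fun ε y => φ y * (1 - η (ε⁻¹ • y))
  have hscale : ∀ ε : ℝ, ContDiff ℝ ∞ fun y : ℂ => η (ε⁻¹ • y) := fun ε =>
    hη.comp (contDiff_const_smul _)
  have hin : ∀ ε, ContDiff ℝ ∞ (inner ε) := fun ε => hφ.mul (hscale ε)
  have hout : ∀ ε, ContDiff ℝ ∞ (outer ε) := fun ε => hφ.mul (contDiff_const.sub (hscale ε))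
  have hinc : ∀ ε, HasCompactSupport (inner ε) := fun ε => hc.mul_right
  have houtc : ∀ ε, HasCompactSupport (outer ε) := fun ε => hc.mul_right
  have hins : ∀ ε, tsupport (inner ε) ⊆ tsupport φ := fun ε => tsupport_mul_subset_left
  have houts : ∀ ε, tsupport (outer ε) ⊆ tsupport φ := fun ε => tsupport_mul_subset_left
  have hbd : ∀ (ε : ℝ) (x : ℂ), |η (ε⁻¹ • x)| ≤ 1 := fun ε x => by
    rw [abs_of_nonneg η.nonneg]; exact η.le_one
  have hFin : ∀ ε, Integrable fun x => F x * inner ε x := fun ε => by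
    have := hF.mul_bdd (c := 1) (hscale ε).continuous.aestronglyMeasurable
      (Eventually.of_forall (hbd ε))
    simpa only [inner, mul_assoc] using this
  have hFout : ∀ ε, Integrable fun x => F x * outer ε x := fun ε => by
    refine (hF.sub (hFin ε)).congr (Eventually.of_forall fun x => ?_)
    simp only [inner, outer, Pi.sub_apply]; ring
  have hui : ∀ ψ : ℂ → ℝ, ContDiff ℝ ∞ ψ → HasCompactSupport ψ → tsupport ψ ⊆ U →
      Integrable fun x => u x * Laplacian.laplacian ψ x := fun ψ h1 h2 h3 =>
    integrable_mul_of_continuousAt_tsupport (continuous_laplacian h1)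
      (hasCompactSupport_laplacian h2) fun x hx => hu0 x (h3 (tsupport_laplacian_subset ψ hx))
  have hA : ∀ ε ∈ Ioo (0 : ℝ) 1,
      A = (∫ x, (u x - u 0) * Laplacian.laplacian (inner ε) x) + ∫ x, F x * inner ε x := by
    intro ε hε
    have h0 : (0 : ℂ) ∉ tsupport (outer ε) := by
      rw [notMem_tsupport_iff_eventuallyEq]
      filter_upwards [ball_mem_nhds (0 : ℂ) hε.1] with y hy
      have : η (ε⁻¹ • y) = 1 := by
        apply η.one_of_mem_closedBall
        have : ‖y‖ < ε := by simpa using hy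
        simp only [mem_closedBall, dist_zero_right, norm_smul, norm_inv, Real.norm_eq_abs,
          abs_of_pos hε.1]
        rw [inv_mul_le_iff₀ hε.1]
        show ‖y‖ ≤ ε * 1
        linarith
      simp only [outer, this, sub_self, mul_zero, Pi.zero_apply]
    have hg := integral_mul_laplacian_eq (u := u) (hout ε) (houtc ε) fun x hx =>
      hu x (hφU (houts ε hx)) (fun h => h0 (h ▸ hx))
    have hg' : ∫ x, Laplacian.laplacian u x * outer ε x = -∫ x, F x * outer ε x := by
      rw [← integral_neg]
      congr 1; ext x
      by_cases hx : x ∈ tsupport (outer ε)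
      · have := heq x (hφU (houts ε hx)) (fun h => h0 (h ▸ hx))
        rw [eq_neg_of_add_eq_zero_left this]; ring
      · simp [image_eq_zero_of_notMem_tsupport hx]
    have hlap : ∀ x, Laplacian.laplacian φ x
        = Laplacian.laplacian (inner ε) x + Laplacian.laplacian (outer ε) x := by
      intro x
      have := (((hin ε).of_le ENat.LEInfty.out).contDiffAt
        (x := x)).laplacian_add
        (((hout ε).of_le ENat.LEInfty.out).contDiffAt)
      rw [← this]
      have : φ = inner ε + outer ε := by ext y; simp only [inner, outer, Pi.add_apply]; ring
      rw [← this]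
    have e1 : ∫ x, u x * Laplacian.laplacian φ x
        = (∫ x, u x * Laplacian.laplacian (inner ε) x)
          + ∫ x, u x * Laplacian.laplacian (outer ε) x := by
      rw [← integral_add (hui _ (hin ε) (hinc ε) ((hins ε).trans hφU))
        (hui _ (hout ε) (houtc ε) ((houts ε).trans hφU))]
      congr 1; ext x; rw [hlap]; ring
    have e2 : ∫ x, F x * φ x = (∫ x, F x * inner ε x) + ∫ x, F x * outer ε x := by
      rw [← integral_add (hFin ε) (hFout ε)]
      congr 1; ext x; simp only [inner, outer]; ring
    have e3 : ∫ x, (u x - u 0) * Laplacian.laplacian (inner ε) x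
        = ∫ x, u x * Laplacian.laplacian (inner ε) x := by
      simp_rw [sub_mul]
      rw [integral_sub (hui _ (hin ε) (hinc ε) ((hins ε).trans hφU))
        (((continuous_laplacian (hin ε)).integrable_of_hasCompactSupport
          (hasCompactSupport_laplacian (hinc ε))).const_mul _), integral_const_mul,
        integral_laplacian_eq_zero (hin ε) (hinc ε)]
      ring
    simp only [A]
    rw [e1, e2, e3, hg, hg']
    ring
  have hI2 : Tendsto (fun ε => ∫ x, F x * inner ε x) (𝓝[>] 0) (𝓝 0) := by
    have := tendsto_integral_filter_of_dominated_convergence (μ := volume) (l := 𝓝[>] (0 : ℝ))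
      (F := fun ε x => F x * inner ε x) (f := fun _ => (0 : ℝ)) (fun x => ‖F x * φ x‖)
      (Eventually.of_forall fun ε => (hFin ε).aestronglyMeasurable)
      (Eventually.of_forall fun ε => Eventually.of_forall fun x => by
        simp only [inner, ← mul_assoc, norm_mul (F x * φ x)]
        exact mul_le_of_le_one_right (norm_nonneg _) (hbd ε x)) hF.norm
      (by
        filter_upwards [Measure.ae_ne volume (0 : ℂ)] with x hx
        refine tendsto_const_nhds.congr' ?_
        have hx' : 0 < ‖x‖ / 2 := by have := norm_pos_iff.2 hx; positivity
        filter_upwards [Ioo_mem_nhdsGT hx'] with ε hε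
        have : η (ε⁻¹ • x) = 0 := by
          apply η.zero_of_le_dist
          rw [dist_zero_right, norm_smul, norm_inv, Real.norm_eq_abs, abs_of_pos hε.1]
          rw [le_inv_mul_iff₀ hε.1]
          show ε * 2 ≤ ‖x‖
          linarith [hε.2]
        simp only [inner, this, mul_zero])
    simpa using this
  have hsmall : ∀ δ > 0, ∀ᶠ ε in 𝓝[>] (0 : ℝ),
      |∫ x, (u x - u 0) * Laplacian.laplacian (inner ε) x| ≤ δ * (C * (4 * π)) := by
    intro δ hδ
    obtain ⟨r, hr, hur⟩ := Metric.continuousAt_iff.1 (hu0 0 h0U) δ hδ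
    filter_upwards [Ioo_mem_nhdsGT (half_pos (half_pos hr)), Ioo_mem_nhdsGT one_pos] with ε hε hε1
    have hsupp : ∀ x ∉ closedBall (0 : ℂ) (2 * ε),
        (u x - u 0) * Laplacian.laplacian (inner ε) x = 0 := by
      intro x hx
      rw [laplacian_zero_of_notMem_tsupport, mul_zero]
      intro h
      apply hx
      refine closure_minimal (fun y hy => ?_) isClosed_closedBall h
      by_contra hy'
      apply hy
      have : η (ε⁻¹ • y) = 0 := by
        apply η.zero_of_le_dist
        have : 2 * ε < ‖y‖ := by simpa using hy'
        rw [dist_zero_right, norm_smul, norm_inv, Real.norm_eq_abs, abs_of_pos hε.1]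
        rw [le_inv_mul_iff₀ hε.1]
        show ε * 2 ≤ ‖y‖
        linarith
      simp only [inner, this, mul_zero]
    rw [← setIntegral_eq_integral_of_forall_compl_eq_zero hsupp, ← Real.norm_eq_abs]
    have hvol : volume.real (closedBall (0 : ℂ) (2 * ε)) = 4 * π * ε ^ 2 := by
      have := hε.1.le
      rw [measureReal_def, Complex.volume_closedBall]
      simp [ENNReal.toReal_ofReal, this]
      ring
    refine (norm_setIntegral_le_of_norm_le_const (C := δ * (C / ε ^ 2)) ?_ ?_).trans_eq ?_
    · exact measure_closedBall_lt_top
    · intro x hx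
      have hx' : dist x 0 < r := by
        have : dist x 0 ≤ 2 * ε := hx
        linarith [hε.2]
      rw [norm_mul]
      gcongr
      · exact (hur hx').le
      · exact hC ε hε1 x
    · rw [hvol]
      have := hε.1.ne'
      field_simp
  have hAle : ∀ δ > 0, |A| ≤ δ * (C * (4 * π)) := by
    intro δ hδ
    have ht : Tendsto (fun ε => |A - ∫ x, F x * inner ε x|) (𝓝[>] 0) (𝓝 |A - 0|) :=
      (tendsto_const_nhds.sub hI2).abs
    rw [sub_zero] at ht
    refine le_of_tendsto ht ?_
    filter_upwards [hsmall δ hδ, Ioo_mem_nhdsGT one_pos] with ε h1 h2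
    rw [hA ε h2, add_sub_cancel_right]
    exact h1
  have hzero : |A| ≤ 0 := by
    have ht : Tendsto (fun δ : ℝ => δ * (C * (4 * π))) (𝓝[>] 0) (𝓝 (0 * (C * (4 * π)))) :=
      ((continuous_id.mul continuous_const).tendsto 0).mono_left nhdsWithin_le_nhds
    rw [zero_mul] at ht
    refine ge_of_tendsto ht ?_
    filter_upwards [self_mem_nhdsWithin] with δ hδ
    exact hAle δ hδ
  exact abs_nonpos_iff.1 hzero

lemma integrableOn_norm_rpow_ball {a : ℝ} (ha : -2 < a) (R : ℝ) :
    IntegrableOn (fun x : ℂ => ‖x‖ ^ a) (ball 0 R) := by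
  have h := (integrable_fun_norm_addHaar (volume : Measure ℂ)
    (f := (Iio R).indicator fun y : ℝ => y ^ a)).2 ?_
  · rw [← integrable_indicator_iff measurableSet_ball]
    refine h.congr (Eventually.of_forall fun x => ?_)
    by_cases hx : ‖x‖ < R <;> simp [indicator, hx]
  · have : IntegrableOn (fun y : ℝ => y ^ (1 + a)) (Ioo 0 R) := by
      rcases le_or_gt R 0 with hR | hR
      · simp [Ioo_eq_empty hR.not_gt]
      · exact (intervalIntegral.integrableOn_Ioo_rpow_iff hR).2 (by linarith)
    rw [← integrable_indicator_iff measurableSet_Ioo] at this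
    rw [← integrable_indicator_iff measurableSet_Ioi]
    refine this.congr (Eventually.of_forall fun y => ?_)
    by_cases h0 : 0 < y <;> by_cases hR : y < R <;>
      simp [indicator, h0, hR, Complex.finrank_real_complex, Real.rpow_add]

/-! ### The Dirichlet problem in the unit disc -/

lemma norm_circleAverage_le {F : ℂ → ℂ} {C : ℝ} (h : ∀ ζ ∈ sphere (0 : ℂ) 1, ‖F ζ‖ ≤ C) :
    ‖Real.circleAverage F 0 1‖ ≤ C := by
  rw [Real.circleAverage_def, norm_smul, Real.norm_of_nonneg (by positivity)]
  have := intervalIntegral.norm_integral_le_of_norm_le_const (a := 0) (b := 2 * π)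
    (f := fun θ => F (circleMap 0 1 θ)) (C := C)
    fun θ _ => h _ (circleMap_mem_sphere 0 zero_le_one θ)
  rw [sub_zero, abs_of_pos Real.two_pi_pos] at this
  rw [inv_mul_le_iff₀ Real.two_pi_pos]
  linarith

/-- The square of the distance to a point `ζ₀` of the unit circle is, on the circle, the harmonic
function `2 - 2 Re (ζ̄₀ ζ)`. -/
lemma dist_sq_eq_on_sphere {ζ ζ₀ : ℂ} (h : ζ ∈ sphere (0 : ℂ) 1) (h₀ : ζ₀ ∈ sphere (0 : ℂ) 1) :
    dist ζ ζ₀ ^ 2 = 2 - 2 * (starRingEnd ℂ ζ₀ * ζ).re := by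
  have h1 : ζ.re ^ 2 + ζ.im ^ 2 = 1 := by
    have : ‖ζ‖ = 1 := by simpa using h
    have e := Complex.sq_norm ζ
    rw [this, Complex.normSq_apply] at e; linarith
  have h2 : ζ₀.re ^ 2 + ζ₀.im ^ 2 = 1 := by
    have : ‖ζ₀‖ = 1 := by simpa using h₀
    have e := Complex.sq_norm ζ₀
    rw [this, Complex.normSq_apply] at e; linarith
  rw [dist_eq_norm, Complex.sq_norm, Complex.normSq_apply]
  simp
  linarith

/-- Korovkin-type majorant of the oscillation of a continuous function on the unit circle. -/
lemma exists_abs_sub_le_harmonic {f : ℂ → ℝ} (hf : ContinuousOn f (sphere 0 1)) {ζ₀ : ℂ}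
    (h₀ : ζ₀ ∈ sphere (0 : ℂ) 1) {ε : ℝ} (hε : 0 < ε) :
    ∃ K : ℝ, 0 ≤ K ∧ ∀ ζ ∈ sphere (0 : ℂ) 1,
      |f ζ - f ζ₀| ≤ ε + K * (2 - 2 * (starRingEnd ℂ ζ₀ * ζ).re) := by
  obtain ⟨B, hB⟩ := (isCompact_sphere (0 : ℂ) 1).exists_bound_of_continuousOn hf
  obtain ⟨δ, hδ, hfδ⟩ := Metric.continuousOn_iff.1 hf ζ₀ h₀ ε hε
  have hB0 : 0 ≤ B := (norm_nonneg _).trans (hB ζ₀ h₀)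
  refine ⟨2 * B / δ ^ 2, by positivity, fun ζ hζ => ?_⟩
  rw [← dist_sq_eq_on_sphere hζ h₀]
  rcases lt_or_ge (dist ζ ζ₀) δ with h | h
  · have := (hfδ ζ hζ h).le
    rw [Real.dist_eq] at this
    have : 0 ≤ 2 * B / δ ^ 2 * dist ζ ζ₀ ^ 2 := by positivity
    linarith
  · have h1 : |f ζ - f ζ₀| ≤ 2 * B := by
      have := (abs_sub (f ζ) (f ζ₀)).trans (add_le_add (hB ζ hζ) (hB ζ₀ h₀))
      linarith
    have h2 : δ ^ 2 ≤ dist ζ ζ₀ ^ 2 := by gcongr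
    have h3 : 2 * B ≤ 2 * B / δ ^ 2 * dist ζ ζ₀ ^ 2 := by
      rw [div_mul_eq_mul_div, le_div_iff₀ (by positivity)]
      gcongr
    linarith

lemma circleIntegrable_re_herglotz_smul {g : ℂ → ℝ} (hg : ContinuousOn g (sphere 0 1)) {w : ℂ}
    (hw : w ∈ ball (0 : ℂ) 1) :
    CircleIntegrable ((Complex.re ∘ herglotzRieszKernel 0 w) • g) 0 1 := by
  apply ContinuousOn.circleIntegrable zero_le_one
  have h1 := continuousOn_herglotzRieszKernel_sphere hw
  rw [abs_one] at h1
  exact (Complex.continuous_re.comp_continuousOn h1).smul hg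

lemma re_herglotzRieszKernel_nonneg {w ζ : ℂ} (hw : w ∈ ball (0 : ℂ) 1)
    (hζ : ζ ∈ sphere (0 : ℂ) 1) : 0 ≤ (herglotzRieszKernel 0 w ζ).re := by
  refine le_trans ?_ (le_re_herglotzRieszKernel hζ hw)
  have : ‖w - 0‖ < 1 := by simpa using hw
  apply div_nonneg <;> linarith [norm_nonneg (w - 0)]

/-- The Poisson integral respects harmonic majorants of the boundary values. -/
lemma circleAverage_re_herglotz_smul_le {g G : ℂ → ℝ} (hg : ContinuousOn g (sphere 0 1))
    (hG : HarmonicOnNhd G (closedBall 0 1)) (h : ∀ ζ ∈ sphere (0 : ℂ) 1, g ζ ≤ G ζ) {w : ℂ}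
    (hw : w ∈ ball (0 : ℂ) 1) :
    Real.circleAverage ((Complex.re ∘ herglotzRieszKernel 0 w) • g) 0 1 ≤ G w := by
  rw [← hG.circleAverage_re_herglotzRieszKernel_smul hw]
  have hGc : ContinuousOn G (sphere 0 1) := fun x hx =>
    (hG x (sphere_subset_closedBall hx)).1.continuousAt.continuousWithinAt
  refine Real.circleAverage_mono (circleIntegrable_re_herglotz_smul hg hw)
    (circleIntegrable_re_herglotz_smul hGc hw) fun ζ hζ => ?_
  rw [abs_one] at hζ
  exact mul_le_mul_of_nonneg_left (h ζ hζ) (re_herglotzRieszKernel_nonneg hw hζ)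

lemma harmonicOnNhd_affine (a K : ℝ) (ζ₀ : ℂ) (s : Set ℂ) :
    HarmonicOnNhd (fun ζ => a + K * (2 - 2 * (starRingEnd ℂ ζ₀ * ζ).re)) s := by
  intro x _
  have h := AnalyticAt.harmonicAt_re (x := x)
    (f := fun ζ : ℂ => (a : ℂ) + K * (2 - 2 * (starRingEnd ℂ ζ₀ * ζ))) (by fun_prop)
  refine (harmonicAt_congr_nhds (Eventually.of_forall fun y => ?_)).1 h
  simp

/-- Solvability of the **Dirichlet problem** in the unit disc for continuous boundary values, by the
Poisson integral. -/
lemma exists_harmonic_extension {f : ℂ → ℝ} (hf : ContinuousOn f (sphere 0 1)) :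
    ∃ ψ : ℂ → ℝ, ContinuousOn ψ (closedBall 0 1) ∧ HarmonicOnNhd ψ (ball 0 1) ∧
      ∀ x ∈ sphere (0 : ℂ) 1, ψ x = f x := by
  classical
  have hfi : CircleIntegrable f 0 1 := hf.circleIntegrable zero_le_one
  have hfi' : CircleIntegrable (fun ζ => (f ζ : ℂ)) 0 1 :=
    ContinuousOn.circleIntegrable zero_le_one (Complex.continuous_ofReal.comp_continuousOn hf)
  set S : ℂ → ℂ := fun w =>
    Real.circleAverage (fun ζ => herglotzRieszKernel 0 w ζ • (f ζ : ℂ)) 0 1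
  have hS : ∀ w ∈ ball (0 : ℂ) 1,
      (S w).re = Real.circleAverage ((Complex.re ∘ herglotzRieszKernel 0 w) • f) 0 1 :=
    fun w hw => re_circleAverage_herglotzRieszKernel_smul hfi hw
  have hSa : AnalyticOnNhd ℂ S (ball 0 1) :=
    analyticOnNhd_circleAverage_herglotzRieszKernel_smul hfi'
  set ψ : ℂ → ℝ := fun w => if w ∈ ball (0 : ℂ) 1 then (S w).re else f w
  have hψ : ∀ x ∈ sphere (0 : ℂ) 1, ψ x = f x := fun x hx =>
    if_neg (sphere_disjoint_ball.notMem_of_mem_left hx)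
  have hharm : HarmonicOnNhd ψ (ball 0 1) := fun x hx => by
    refine (harmonicAt_congr_nhds ?_).1 (hSa x hx).harmonicAt_re
    filter_upwards [isOpen_ball.mem_nhds hx] with y hy
    exact (if_pos hy).symm
  refine ⟨ψ, fun x hx => ?_, hharm, hψ⟩
  by_cases hxb : x ∈ ball (0 : ℂ) 1
  · exact (hharm x hxb).1.continuousAt.continuousWithinAt
  have hxs : x ∈ sphere (0 : ℂ) 1 := by
    have h1 : dist x 0 ≤ 1 := hx
    have h2 : ¬ dist x 0 < 1 := hxb
    exact le_antisymm h1 (not_lt.1 h2)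
  rw [ContinuousWithinAt, Metric.tendsto_nhds]
  intro ε hε
  obtain ⟨K, hK, hfK⟩ := exists_abs_sub_le_harmonic hf hxs (half_pos hε)
  have hbound : ∀ w ∈ closedBall (0 : ℂ) 1,
      |ψ w - f x| ≤ ε / 2 + K * (2 - 2 * (starRingEnd ℂ x * w).re) := by
    intro w hw
    by_cases hwb : w ∈ ball (0 : ℂ) 1
    · have e : ψ w = (S w).re := if_pos hwb
      have h1 := circleAverage_re_herglotz_smul_le hf
        (harmonicOnNhd_affine (f x + ε / 2) K x _)
        (fun ζ hζ => by have := (abs_le.1 (hfK ζ hζ)).2; linarith) hwb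
      have h2 := circleAverage_re_herglotz_smul_le hf.neg
        (harmonicOnNhd_affine (-f x + ε / 2) K x _)
        (fun ζ hζ => by
          have := (abs_le.1 (hfK ζ hζ)).1
          rw [Pi.neg_apply]
          linarith) hwb
      have h3 : Real.circleAverage ((Complex.re ∘ herglotzRieszKernel 0 w) • (-f)) 0 1
          = -Real.circleAverage ((Complex.re ∘ herglotzRieszKernel 0 w) • f) 0 1 := by
        rw [← neg_one_smul ℝ (Real.circleAverage _ 0 1), ← Real.circleAverage_smul]
        congr 1; ext ζ; simp
      rw [h3] at h2
      rw [e, hS w hwb, abs_le]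
      constructor <;> linarith
    · have hws : w ∈ sphere (0 : ℂ) 1 := by
        have h1 : dist w 0 ≤ 1 := hw
        have h2 : ¬ dist w 0 < 1 := hwb
        exact le_antisymm h1 (not_lt.1 h2)
      rw [hψ w hws]
      exact hfK w hws
  have hlim : Tendsto (fun w : ℂ => ε / 2 + K * (2 - 2 * (starRingEnd ℂ x * w).re))
      (𝓝[closedBall 0 1] x) (𝓝 (ε / 2 + K * (2 - 2 * (starRingEnd ℂ x * x).re))) :=
    Continuous.continuousWithinAt (by fun_prop)
  rw [← dist_sq_eq_on_sphere hxs hxs, dist_self] at hlim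
  have hlt : ε / 2 + K * 0 ^ 2 < ε := by linarith
  filter_upwards [hlim.eventually (gt_mem_nhds hlt), self_mem_nhdsWithin] with w h1 h2
  rw [hψ x hxs, Real.dist_eq]
  exact (hbound w h2).trans_lt h1

/-- Gradient estimate at the centre for a harmonic function with small boundary values. -/
lemma abs_fderiv_zero_le_of_harmonic {χ : ℂ → ℝ} (hc : ContinuousOn χ (closedBall 0 1))
    (hχ : HarmonicOnNhd χ (ball 0 1)) {ε : ℝ} (hε : ∀ x ∈ sphere (0 : ℂ) 1, |χ x| ≤ ε) :
    |fderiv ℝ χ 0 1| ≤ 2 * ε := by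
  have hcs : ContinuousOn χ (sphere 0 1) := hc.mono sphere_subset_closedBall
  have h0 : (0 : ℂ) ∈ ball (0 : ℂ) 1 := by simp
  have hi : CircleIntegrable (fun ζ => (χ ζ : ℂ)) 0 1 :=
    ContinuousOn.circleIntegrable zero_le_one (Complex.continuous_ofReal.comp_continuousOn hcs)
  have hd := hasDerivAt_circleAverage_herglotzRieszKernel_smul hi h0
  have hre : χ =ᶠ[𝓝 0] fun w =>
      (Real.circleAverage (fun ζ => herglotzRieszKernel 0 w ζ • (χ ζ : ℂ)) 0 1).re := by
    filter_upwards [isOpen_ball.mem_nhds h0] with w hw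
    rw [re_circleAverage_herglotzRieszKernel_smul (hcs.circleIntegrable zero_le_one) hw,
      (HarmonicContOnCl.mk_ball hχ hc).circleAverage_re_herglotzRieszKernel_smul hw]
  have hd' := (Complex.reCLM.hasFDerivAt.comp (0 : ℂ)
    (hd.hasFDerivAt.restrictScalars ℝ)).congr_of_eventuallyEq hre
  rw [hd'.fderiv]
  simp only [ContinuousLinearMap.comp_apply]
  refine (Complex.abs_re_le_norm _).trans ?_
  simp only [ContinuousLinearMap.coe_restrictScalars', ContinuousLinearMap.toSpanSingleton_apply,
    one_smul]
  refine norm_circleAverage_le fun ζ hζ => ?_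
  have hn : ‖ζ‖ = 1 := by simpa using hζ
  simpa [hn] using hε ζ hζ

/-! ### Uniform estimates for the pulled back solutions -/

/-- The largest value of the conformal radius that occurs on the disc of radius `2`. -/
noncomputable def maxRadius (p : ℝ) : ℝ := (2 * Real.exp (1 / 2)) ^ p

lemma maxRadius_pos (p : ℝ) : 0 < maxRadius p := by unfold maxRadius; positivity

/-- A blowing-up sequence of radial profiles for the coefficient `exp (b r ^ 2)` with small `b`. The
masses stay bounded, and near `s = 1` they are within `η` of the total mass `2` of the entire
solution with constant coefficient. -/
lemma exists_radialProfile_family {p η : ℝ} (hp : 0 < p) (hη : 0 < η) :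
    ∃ b C : ℝ, ∃ v g f : ℕ → ℝ → ℝ, 0 < b ∧ 0 < C ∧
      (∀ k, IsRadialProfile (p ^ 2)⁻¹ (fun s => b * s ^ (2 / p)) (maxRadius p)
        (v k) (g k) (f k)) ∧
      Tendsto (fun k => v k 0) atTop atTop ∧
      (∀ k, ∀ s ∈ Ioc 0 (maxRadius p), |s * g k s| ≤ C) ∧
      (∀ k, ∀ s ∈ Ioc 0 (maxRadius p), s * Real.exp (v k s) ≤ C) ∧
      ∀ k, ∀ s ∈ Icc (Real.exp (-(p / 4))) (Real.exp (p / 4)), |s * g k s - 2| ≤ η := by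
  set R : ℝ := 2 * Real.exp (1 / 2)
  have hR : 0 < R := by positivity
  set δ : ℝ := η / 2
  have hδ : 0 < δ := by positivity
  -- With this `b`, the logarithmic derivative of `exp (b s ^ (2 / p))` is at most `δ`.
  set b : ℝ := δ * p / (2 * R ^ 2)
  have hb : 0 < b := by positivity
  -- The initial values are large enough for the mass to exceed `2 - η` before `s = exp (-p / 4)`.
  set k₀ : ℝ := Real.log (4 * p ^ 2 * (1 + δ) * Real.exp (p / 4) / η)
  have hκc : Continuous fun s : ℝ => b * s ^ (2 / p) :=
    continuous_const.mul (continuous_id.rpow_const fun _ => Or.inr (by positivity))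
  choose v g f hv hv0 using fun k : ℕ => exists_isRadialProfile (c := (p ^ 2)⁻¹) (by positivity)
    hκc (maxRadius_pos p).le (k₀ + k)
  have hc : 0 < (p ^ 2)⁻¹ := by positivity
  have hκ : ∀ s ∈ Ioo 0 (maxRadius p),
      HasDerivAt (fun s : ℝ => b * s ^ (2 / p)) (b * (2 / p * s ^ (2 / p - 1))) s := fun s hs =>
    (Real.hasDerivAt_rpow_const (Or.inl hs.1.ne')).const_mul b
  have hκ' : ∀ s ∈ Ioo 0 (maxRadius p), s * (b * (2 / p * s ^ (2 / p - 1))) ∈ Icc 0 δ := by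
    intro s hs
    have h0 := hs.1
    have e : s * (b * (2 / p * s ^ (2 / p - 1))) = b * (2 / p) * s ^ (2 / p) := by
      rw [Real.rpow_sub_one h0.ne']; field_simp
    rw [e]
    refine ⟨by positivity, ?_⟩
    have h1 : s ^ (2 / p) ≤ R ^ 2 := by
      calc s ^ (2 / p) ≤ (maxRadius p) ^ (2 / p) :=
            Real.rpow_le_rpow h0.le hs.2.le (by positivity)
        _ = R ^ 2 := by
            rw [maxRadius, ← Real.rpow_mul hR.le, mul_div_cancel₀ _ hp.ne', Real.rpow_two]
    calc b * (2 / p) * s ^ (2 / p) ≤ b * (2 / p) * R ^ 2 := by gcongr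
      _ = δ := by simp only [b]; field_simp
  refine ⟨b, max (2 * (1 + δ)) (p ^ 2 * ((1 + δ) ^ 2 / 2)), v, g, f, hb, by positivity, hv, ?_, ?_,
    ?_, ?_⟩
  · simp_rw [hv0]
    exact tendsto_atTop_add_const_left _ _ tendsto_natCast_atTop_atTop
  · intro k s hs
    rw [abs_of_pos ((hv k).mass_pos hc hs)]
    exact ((hv k).mass_le hc hκ hκ' hs).trans (le_max_left _ _)
  · intro k s hs
    have h1 := (hv k).mul_density_le hc hκ hκ' hs
    have h0 := hs.1
    rw [(hv k).density_eq s ⟨hs.1.le, hs.2⟩] at h1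
    have h2 : Real.exp (v k s) ≤ Real.exp (b * s ^ (2 / p) + v k s) := by
      apply Real.exp_le_exp.2
      have : 0 ≤ b * s ^ (2 / p) := by positivity
      linarith
    refine le_trans ?_ (le_max_right _ _)
    calc s * Real.exp (v k s) ≤ s * Real.exp (b * s ^ (2 / p) + v k s) := by gcongr
      _ = p ^ 2 * (s * ((p ^ 2)⁻¹ * Real.exp (b * s ^ (2 / p) + v k s))) := by field_simp
      _ ≤ _ := by gcongr
  · intro k s hs
    have hs0 : 0 < s := (Real.exp_pos _).trans_le hs.1
    have hsL : s ≤ maxRadius p := by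
      refine hs.2.trans ?_
      rw [maxRadius, Real.mul_rpow two_pos.le (Real.exp_pos _).le, ← Real.exp_mul]
      have h1 : (1 : ℝ) ≤ 2 ^ p := Real.one_le_rpow one_le_two hp.le
      have h2 : Real.exp (p / 4) ≤ Real.exp (1 / 2 * p) := Real.exp_le_exp.2 (by linarith)
      nlinarith [Real.exp_pos (p / 4)]
    have hm := (hv k).mass_le hc hκ hκ' ⟨hs0, hsL⟩
    have hl := (hv k).two_sub_mass_le hc hκ hκ' ⟨hs0, hsL⟩
    rw [abs_le]
    refine ⟨?_, by simp only [δ] at hm; linarith⟩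
    have hf0 : 4 * (1 + δ) * Real.exp (p / 4) / η ≤ f k 0 := by
      rw [(hv k).density_eq 0 ⟨le_rfl, (maxRadius_pos p).le⟩, hv0,
        Real.zero_rpow (by positivity), mul_zero, zero_add, Real.exp_add,
        Real.exp_log (by positivity)]
      have : 1 ≤ Real.exp (k : ℝ) := Real.one_le_exp (by positivity)
      calc 4 * (1 + δ) * Real.exp (p / 4) / η
          = (p ^ 2)⁻¹ * (4 * p ^ 2 * (1 + δ) * Real.exp (p / 4) / η * 1) := by field_simp
        _ ≤ _ := by gcongr
    have hg : g k s ≤ 2 * (1 + δ) * Real.exp (p / 4) := by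
      have h1 : 1 ≤ s * Real.exp (p / 4) := by
        have := mul_le_mul_of_nonneg_right hs.1 (Real.exp_pos (p / 4)).le
        rwa [← Real.exp_add, neg_add_cancel, Real.exp_zero] at this
      have h2 := (hv k).slope_pos hc ⟨hs0.le, hsL⟩
      calc g k s ≤ g k s * (s * Real.exp (p / 4)) := le_mul_of_one_le_right h2.le h1
        _ = s * g k s * Real.exp (p / 4) := by ring
        _ ≤ _ := by gcongr
    have hη' : 2 / f k 0 * g k s ≤ η := by
      have hpos : 0 < 4 * (1 + δ) * Real.exp (p / 4) / η := by positivity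
      calc 2 / f k 0 * g k s
          ≤ 2 / (4 * (1 + δ) * Real.exp (p / 4) / η) * (2 * (1 + δ) * Real.exp (p / 4)) := by
            gcongr
            exact ((hv k).slope_pos hc ⟨hs0.le, hsL⟩).le
        _ = η := by field_simp; norm_num
    linarith

section Geometry

variable {p β : ℝ}

lemma norm_one_add_mem_Icc (h0 : 0 ≤ β) (hβ : β ≤ 1 / 4) {z : ℂ} (hz : ‖z‖ ≤ 2) :
    ‖1 + β * z‖ ∈ Icc (1 / 2 : ℝ) 2 := by
  have h1 : ‖(β : ℂ) * z‖ ≤ 1 / 2 := by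
    rw [norm_mul, Complex.norm_real, Real.norm_of_nonneg h0]
    nlinarith [norm_nonneg z]
  have h2 := norm_add_le (1 : ℂ) (β * z)
  have h3 := norm_sub_le_norm_add (1 : ℂ) (β * z)
  rw [norm_one] at h2 h3
  constructor <;> linarith

lemma one_add_ne_zero (h0 : 0 ≤ β) (hβ : β ≤ 1 / 4) {z : ℂ} (hz : ‖z‖ ≤ 2) : 1 + β * z ≠ 0 := by
  rw [← norm_pos_iff]
  exact lt_of_lt_of_le (by norm_num) (norm_one_add_mem_Icc h0 hβ hz).1

lemma abs_mul_re_le (h0 : 0 ≤ β) (hβ : β ≤ 1 / 4) {z : ℂ} (hz : ‖z‖ ≤ 2) :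
    |β * z.re| ≤ 1 / 2 := by
  rw [abs_mul, abs_of_nonneg h0]
  nlinarith [Complex.abs_re_le_norm z, abs_nonneg z.re]

lemma abs_conformalCorrection_le (hp : 0 < p) (h0 : 0 ≤ β) (hβ : β ≤ 1 / 4) {z : ℂ}
    (hz : ‖z‖ ≤ 2) : |conformalCorrection p β z| ≤ 2 + p := by
  obtain ⟨h1, h2⟩ := norm_one_add_mem_Icc h0 hβ hz
  have hpos : 0 < ‖1 + β * z‖ := by linarith
  have h3 : Real.log ‖1 + β * z‖ ≤ 1 := by
    have := Real.log_le_sub_one_of_pos hpos; linarith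
  have h4 : -1 ≤ Real.log ‖1 + β * z‖ := by
    have := Real.one_sub_inv_le_log_of_pos hpos
    have h5 : ‖1 + β * z‖⁻¹ ≤ 2 := by rw [inv_le_comm₀ hpos two_pos]; linarith
    linarith
  have h5 := abs_mul_re_le h0 hβ hz
  rw [abs_le] at h5 ⊢
  unfold conformalCorrection
  rw [mul_assoc p]
  constructor <;> nlinarith

lemma conformalRadius_pos {z : ℂ} (hz : z ≠ 0) : 0 < conformalRadius p β z := by
  rw [conformalRadius_eq_exp p β hz]; positivity

lemma log_conformalRadius {z : ℂ} (hz : z ≠ 0) :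
    Real.log (conformalRadius p β z) = p * (Real.log ‖z‖ + β * z.re) := by
  rw [conformalRadius_eq_exp p β hz, Real.log_exp]

lemma conformalRadius_le (hp : 0 < p) (h0 : 0 ≤ β) (hβ : β ≤ 1 / 4) {z : ℂ} (hz : ‖z‖ ≤ 2) :
    conformalRadius p β z ≤ maxRadius p := by
  rw [maxRadius, conformalRadius, Real.mul_rpow two_pos.le (Real.exp_pos _).le, ← Real.exp_mul]
  have h := (abs_le.1 (abs_mul_re_le h0 hβ hz)).2
  refine mul_le_mul (Real.rpow_le_rpow (norm_nonneg z) hz hp.le) (Real.exp_le_exp.2 ?_)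
    (Real.exp_pos _).le (by positivity)
  rw [mul_assoc, mul_comm]
  gcongr

lemma continuousAt_pulledBack (hp : 0 < p) (h0 : 0 ≤ β) (hβ : β ≤ 1 / 4) {v : ℝ → ℝ}
    (hv : Continuous v) {z : ℂ} (hz : ‖z‖ ≤ 2) : ContinuousAt (pulledBack p β v) z :=
  (hv.comp (continuous_conformalRadius hp.le β)).continuousAt.add
    (harmonicAt_conformalCorrection p β (one_add_ne_zero h0 hβ hz)).1.continuousAt

lemma abs_pulledBack_sub_le (hp : 0 < p) (h0 : 0 ≤ β) (hβ : β ≤ 1 / 4) {c C : ℝ}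
    {κ v g f : ℝ → ℝ} (h : IsRadialProfile c κ (maxRadius p) v g f)
    (hC : ∀ s ∈ Ioc 0 (maxRadius p), |s * g s| ≤ C) {x y : ℂ} (hx : x ≠ 0) (hy : y ≠ 0)
    (hx2 : ‖x‖ ≤ 2) (hy2 : ‖y‖ ≤ 2) :
    |pulledBack p β v x - pulledBack p β v y|
      ≤ C * (p * (|Real.log ‖x‖ - Real.log ‖y‖| + 1)) + 2 * (2 + p) := by
  have hpx := conformalRadius_pos (p := p) (β := β) hx
  have hpy := conformalRadius_pos (p := p) (β := β) hy
  have hmin : 0 < min (conformalRadius p β x) (conformalRadius p β y) := lt_min hpx hpy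
  have h1 := h.abs_add_mul_log_sub_le (A := 0) (K := C) (b := maxRadius p) hmin
    (fun s hs => by simpa using hC s ⟨hmin.trans_le hs.1, hs.2⟩)
    ⟨min_le_left _ _, conformalRadius_le hp h0 hβ hx2⟩
    ⟨min_le_right _ _, conformalRadius_le hp h0 hβ hy2⟩
  rw [zero_mul, zero_mul, add_zero, add_zero, log_conformalRadius hx, log_conformalRadius hy,
    ← mul_sub, abs_mul, abs_of_pos hp] at h1
  have hC0 : 0 ≤ C := (abs_nonneg _).trans (hC _ ⟨maxRadius_pos p, le_rfl⟩)
  have h2 : |Real.log ‖x‖ + β * x.re - (Real.log ‖y‖ + β * y.re)|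
      ≤ |Real.log ‖x‖ - Real.log ‖y‖| + 1 := by
    have e : Real.log ‖x‖ + β * x.re - (Real.log ‖y‖ + β * y.re)
        = (Real.log ‖x‖ - Real.log ‖y‖) + (β * x.re - β * y.re) := by ring
    rw [e]
    refine (abs_add_le _ _).trans ?_
    have := abs_sub (β * x.re) (β * y.re)
    have := abs_mul_re_le h0 hβ hx2
    have := abs_mul_re_le h0 hβ hy2
    linarith
  have h3 := abs_conformalCorrection_le hp h0 hβ hx2
  have h4 := abs_conformalCorrection_le hp h0 hβ hy2
  have h5 : C * (p * |Real.log ‖x‖ + β * x.re - (Real.log ‖y‖ + β * y.re)|)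
      ≤ C * (p * (|Real.log ‖x‖ - Real.log ‖y‖| + 1)) := by gcongr
  have e : pulledBack p β v x - pulledBack p β v y
      = (v (conformalRadius p β x) - v (conformalRadius p β y))
        + (conformalCorrection p β x - conformalCorrection p β y) := by
    unfold pulledBack; ring
  rw [e]
  refine (abs_add_le _ _).trans ?_
  have := abs_sub (conformalCorrection p β x) (conformalCorrection p β y)
  linarith

/-- Away from the origin the solutions are bounded above, no matter how large the profile is at
zero. -/
lemma pulledBack_le (hp : 0 < p) (h0 : 0 ≤ β) (hβ : β ≤ 1 / 4) {C r : ℝ} {v : ℝ → ℝ}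
    (hC : ∀ s ∈ Ioc 0 (maxRadius p), s * Real.exp (v s) ≤ C) (hr : 0 < r) {x : ℂ}
    (hx : r ≤ ‖x‖) (hx2 : ‖x‖ ≤ 2) :
    pulledBack p β v x ≤ Real.log C - p * (Real.log r - 1 / 2) + (2 + p) := by
  have hx0 : x ≠ 0 := norm_pos_iff.1 (hr.trans_le hx)
  have hpos := conformalRadius_pos (p := p) (β := β) hx0
  have h1 := Real.log_le_log (by positivity)
    (hC _ ⟨hpos, conformalRadius_le hp h0 hβ hx2⟩)
  rw [Real.log_mul hpos.ne' (Real.exp_pos _).ne', Real.log_exp, log_conformalRadius hx0] at h1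
  have h2 := Real.log_le_log hr hx
  have h3 := (abs_le.1 (abs_mul_re_le h0 hβ hx2)).1
  have h4 := (abs_le.1 (abs_conformalCorrection_le hp h0 hβ hx2)).2
  have h5 : p * (Real.log r - 1 / 2) ≤ p * (Real.log ‖x‖ + β * x.re) := by gcongr; linarith
  unfold pulledBack
  linarith

end Geometry

lemma contDiff_norm_sq_mul_exp (β : ℝ) :
    ContDiff ℝ ∞ fun z : ℂ => ‖z‖ ^ 2 * Real.exp (2 * β * z.re) := by
  have h1 : ContDiff ℝ ∞ fun z : ℂ => z.re := Complex.reCLM.contDiff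
  exact (contDiff_norm_sq ℝ).mul (contDiff_const.mul h1).exp

lemma contDiff_expCoefficient (b β : ℝ) : ContDiff ℝ ∞ (expCoefficient b β) :=
  (contDiff_const.mul (contDiff_norm_sq_mul_exp β)).exp

lemma log_expCoefficient (b β : ℝ) (z : ℂ) :
    Real.log (expCoefficient b β z) = b * (‖z‖ ^ 2 * Real.exp (2 * β * z.re)) := by
  rw [expCoefficient, Real.log_exp]

lemma exists_coefficientBounds {b : ℝ} (hb : 0 < b) (β : ℝ) :
    ∃ c₁ : ℝ, 0 < c₁ ∧ CoefficientBounds (fun _ => expCoefficient b β) c₁ := by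
  have hs := contDiff_expCoefficient b β
  have hB : ∀ n : ℕ, ∃ B : ℝ, ∀ x ∈ closedBall (0 : ℂ) 1,
      ‖iteratedFDeriv ℝ n (expCoefficient b β) x‖ ≤ B := fun n =>
    (isCompact_closedBall (0 : ℂ) 1).exists_bound_of_continuousOn
      (hs.continuous_iteratedFDeriv (m := n) (by exact_mod_cast le_top)).continuousOn
  choose B hB using hB
  set c₁ : ℝ := 1 + ∑ n ∈ Finset.range 4, |B n|
  have hc : ∀ n ∈ Finset.range 4, B n ≤ c₁ := fun n hn => by
    have := Finset.single_le_sum (f := fun n => |B n|) (fun i _ => abs_nonneg _) hn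
    have := le_abs_self (B n)
    simp only [c₁]; linarith
  have hc1 : 1 ≤ c₁ := by
    have : 0 ≤ ∑ n ∈ Finset.range 4, |B n| := Finset.sum_nonneg fun _ _ => abs_nonneg _
    simp only [c₁]; linarith
  refine ⟨c₁, by linarith, fun k => ⟨hs.contDiffOn, fun x hx => ⟨?_, ?_, fun n hn => ?_⟩⟩⟩
  · have h1 : 1 / c₁ ≤ 1 := by rw [div_le_one (by linarith)]; exact hc1
    refine h1.trans (Real.one_le_exp ?_)
    positivity
  · have := (hB 0 x (ball_subset_closedBall hx)).trans (hc 0 (by simp))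
    rw [norm_iteratedFDeriv_zero] at this
    exact (le_abs_self _).trans this
  · rw [Finset.mem_Icc] at hn
    exact (hB n x (ball_subset_closedBall hx)).trans (hc n (by rw [Finset.mem_range]; omega))

lemma hasFDerivAt_log_expCoefficient (b β : ℝ) (y : ℂ) :
    HasFDerivAt (fun z => Real.log (expCoefficient b β z))
      (b • (‖y‖ ^ 2 • (Real.exp (2 * β * y.re) • ((2 * β) • Complex.reCLM))
        + Real.exp (2 * β * y.re) • (2 • innerSL ℝ y))) y := by
  simp_rw [log_expCoefficient]
  have h1 : HasFDerivAt (fun z : ℂ => Real.exp (2 * β * z.re)) _ y :=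
    (Complex.reCLM.hasFDerivAt.const_mul (2 * β)).exp
  exact ((hasStrictFDerivAt_norm_sq y).hasFDerivAt.mul h1).const_mul b

lemma gradient_log_expCoefficient_zero (b β : ℝ) :
    gradient (fun z => Real.log (expCoefficient b β z)) 0 = 0 := by
  apply HasGradientAt.gradient
  rw [hasGradientAt_iff_hasFDerivAt, map_zero]
  refine (hasFDerivAt_log_expCoefficient b β 0).congr_fderiv ?_
  ext e
  simp

lemma laplacian_log_expCoefficient_zero (b β : ℝ) :
    Laplacian.laplacian (fun z => Real.log (expCoefficient b β z)) 0 = 4 * b := by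
  have hc : ContDiffAt ℝ 2 (fun z => Real.log (expCoefficient b β z)) 0 := by
    simp_rw [log_expCoefficient]
    exact ((contDiff_const.mul (contDiff_norm_sq_mul_exp β)).of_le ENat.LEInfty.out).contDiffAt
  have key : ∀ e : ℂ, ‖e‖ = 1 →
      fderiv ℝ (fun y => fderiv ℝ (fun z => Real.log (expCoefficient b β z)) y e) 0 e = 2 * b := by
    intro e he
    have h1 : (fun y => fderiv ℝ (fun z => Real.log (expCoefficient b β z)) y e)
        = fun y : ℂ => ‖y‖ ^ 2 * (b * (Real.exp (2 * β * y.re) * (2 * β * e.re)))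
          + innerSL ℝ e y * (2 * b * Real.exp (2 * β * y.re)) := by
      ext y
      rw [(hasFDerivAt_log_expCoefficient b β y).fderiv]
      simp [Complex.inner]
      ring
    have h2 : HasFDerivAt (fun z : ℂ => Real.exp (2 * β * z.re)) _ 0 :=
      (Complex.reCLM.hasFDerivAt.const_mul (2 * β)).exp
    have h3 : HasFDerivAt (fun y : ℂ => ‖y‖ ^ 2 * (b * (Real.exp (2 * β * y.re) * (2 * β * e.re)))
        + innerSL ℝ e y * (2 * b * Real.exp (2 * β * y.re))) _ 0 :=
      ((hasStrictFDerivAt_norm_sq (0 : ℂ)).hasFDerivAt.mul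
        ((h2.mul_const (2 * β * e.re)).const_mul b)).add
        (((innerSL ℝ e).hasFDerivAt).mul (h2.const_mul (2 * b)))
    rw [h1, h3.fderiv]
    simp [he]
  rw [hc.laplacian_eq_fderiv_fderiv, key 1 (by simp), key Complex.I (by simp)]
  ring

/-! ### Energy, boundary values and the blow-up sequence -/

section Solution

variable {p β b C : ℝ} {v g f : ℝ → ℝ}

/-- The nonlinear term `|x| ^ (2 α) h e ^ u` of the pulled back solution, with `2 α = p - 2`. -/
noncomputable def liouvilleDensity (p β b : ℝ) (v : ℝ → ℝ) (z : ℂ) : ℝ :=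
  ‖z‖ ^ (p - 2) * expCoefficient b β z * Real.exp (pulledBack p β v z)

lemma liouvilleDensity_nonneg (p β b : ℝ) (v : ℝ → ℝ) (z : ℂ) :
    0 ≤ liouvilleDensity p β b v z := by
  unfold liouvilleDensity expCoefficient; positivity

lemma integrableOn_liouvilleDensity (hp : 0 < p) (h0 : 0 ≤ β) (hβ : β ≤ 1 / 4)
    (hv : Continuous v) : IntegrableOn (liouvilleDensity p β b v) (ball 0 2) := by
  have h1 := integrableOn_norm_rpow_ball (a := p - 2) (by linarith) 2
  have h2 : ContinuousOn (fun z => expCoefficient b β z * Real.exp (pulledBack p β v z))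
      (closedBall 0 2) := fun z hz =>
    ((contDiff_expCoefficient b β).continuous.continuousAt.mul
      (continuousAt_pulledBack hp h0 hβ hv (by simpa using hz)).rexp).continuousWithinAt
  have h3 := h1.mul_continuousOn_of_subset h2 measurableSet_ball (isCompact_closedBall 0 2)
    ball_subset_closedBall
  refine h3.congr_fun (fun z _ => ?_) measurableSet_ball
  simp only [liouvilleDensity]
  ring

lemma integrable_liouvilleDensity_mul (hp : 0 < p) (h0 : 0 ≤ β) (hβ : β ≤ 1 / 4)
    (hv : Continuous v) {φ : ℂ → ℝ} (hφ : Continuous φ) (hφU : tsupport φ ⊆ ball 0 2) :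
    Integrable fun z => liouvilleDensity p β b v z * φ z := by
  have h := (integrableOn_liouvilleDensity (b := b) hp h0 hβ hv).mul_continuousOn_of_subset
    hφ.continuousOn measurableSet_ball (isCompact_closedBall 0 2) ball_subset_closedBall
  refine (integrableOn_iff_integrable_of_support_subset fun z hz => hφU (subset_tsupport _ ?_)).1 h
  exact right_ne_zero_of_mul hz

/-- The pulled back solution solves the equation on the disc of radius `2` in the sense of
distributions. -/
lemma integral_pulledBack_mul_laplacian (hp : 0 < p) (h0 : 0 ≤ β) (hβ : β ≤ 1 / 4)
    (h : IsRadialProfile ((p ^ 2)⁻¹) (fun s => b * s ^ (2 / p)) (maxRadius p) v g f) {φ : ℂ → ℝ}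
    (hφ : ContDiff ℝ ∞ φ) (hc : HasCompactSupport φ) (hφU : tsupport φ ⊆ ball 0 2) :
    (∫ z, pulledBack p β v z * Laplacian.laplacian φ z)
      + ∫ z, liouvilleDensity p β b v z * φ z = 0 := by
  have hle : ∀ z ∈ ball (0 : ℂ) 2, ‖z‖ ≤ 2 := fun z hz => by
    have : ‖z‖ < 2 := by simpa using hz
    exact this.le
  exact integral_mul_laplacian_add_eq_zero (U := ball 0 2)
    (fun z hz => continuousAt_pulledBack hp h0 hβ h.continuous (hle z hz)) (by simp)
    (fun z hz hz0 => contDiffAt_pulledBack h hz0 (one_add_ne_zero h0 hβ (hle z hz)))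
    (fun z hz hz0 => laplacian_pulledBack hp h hz0 (one_add_ne_zero h0 hβ (hle z hz))
      (conformalRadius_le hp h0 hβ (hle z hz))) hφ hc hφU
    (integrable_liouvilleDensity_mul hp h0 hβ h.continuous hφ.continuous hφU)

lemma isLiouvilleSolution_pulledBack {α : ℝ} (hpα : 2 * α = p - 2) (hp : 0 < p) (h0 : 0 ≤ β)
    (hβ : β ≤ 1 / 4)
    (h : IsRadialProfile ((p ^ 2)⁻¹) (fun s => b * s ^ (2 / p)) (maxRadius p) v g f) :
    IsLiouvilleSolution α (expCoefficient b β) (pulledBack p β v) := by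
  have hle : ∀ z ∈ closedBall (0 : ℂ) 1, ‖z‖ ≤ 2 := fun z hz => by
    have : ‖z‖ ≤ 1 := by simpa using hz
    linarith
  have hle' : ∀ z ∈ ball (0 : ℂ) 1 \ {0}, ‖z‖ ≤ 2 := fun z hz =>
    hle z (ball_subset_closedBall hz.1)
  refine ⟨fun z hz => (continuousAt_pulledBack hp h0 hβ h.continuous (hle z hz)).continuousWithinAt,
    fun z hz => (contDiffAt_pulledBack h hz.2
      (one_add_ne_zero h0 hβ (hle' z hz))).contDiffWithinAt, fun z hz => ?_,
    fun φ hφ hc hφU => ?_⟩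
  · rw [hpα]
    exact laplacian_pulledBack hp h hz.2 (one_add_ne_zero h0 hβ (hle' z hz))
      (conformalRadius_le hp h0 hβ (hle' z hz))
  · rw [hpα, setIntegral_eq_integral_of_forall_compl_eq_zero,
      setIntegral_eq_integral_of_forall_compl_eq_zero]
    · exact integral_pulledBack_mul_laplacian hp h0 hβ h hφ hc
        (hφU.trans (ball_subset_ball one_le_two))
    · intro z hz
      rw [image_eq_zero_of_notMem_tsupport fun hz' => hz (hφU hz'), mul_zero]
    · intro z hz
      rw [laplacian_zero_of_notMem_tsupport fun hz' => hz (hφU hz'), mul_zero]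

/-- Uniform energy bound: testing the equation with a cut-off function `φ` that is `1` on `B₁`
expresses the energy through the oscillation of the solution on the annulus where `Δ φ` lives. -/
lemma setIntegral_liouvilleDensity_le (hp : 0 < p) (h0 : 0 ≤ β) (hβ : β ≤ 1 / 4) :
    ∃ A : ℝ, ∀ (v g f : ℝ → ℝ),
      IsRadialProfile ((p ^ 2)⁻¹) (fun s => b * s ^ (2 / p)) (maxRadius p) v g f →
      (∀ s ∈ Ioc 0 (maxRadius p), |s * g s| ≤ C) →
      ∫ z in ball (0 : ℂ) 1, liouvilleDensity p β b v z < A := by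
  let φ : ContDiffBump (0 : ℂ) := ⟨1, 3 / 2, one_pos, by norm_num⟩
  have hφ : ContDiff ℝ ∞ φ := φ.contDiff
  have hφU : tsupport φ ⊆ ball 0 2 := by
    rw [φ.tsupport_eq]; exact closedBall_subset_ball (by norm_num)
  have hΔi : Integrable fun z => |Laplacian.laplacian (⇑φ) z| :=
    ((continuous_laplacian hφ).integrable_of_hasCompactSupport
      (hasCompactSupport_laplacian φ.hasCompactSupport)).abs
  set D : ℝ := C * (p * (1 + 1)) + 2 * (2 + p)
  refine ⟨(∫ z, D * |Laplacian.laplacian (⇑φ) z|) + 1, fun v g f h hC => ?_⟩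
  have hi := integrable_liouvilleDensity_mul (b := b) hp h0 hβ h.continuous hφ.continuous hφU
  have hi1 : IntegrableOn (liouvilleDensity p β b v) (ball 0 1) :=
    (integrableOn_liouvilleDensity hp h0 hβ h.continuous).mono_set (ball_subset_ball one_le_two)
  have h1 : ∫ z in ball (0 : ℂ) 1, liouvilleDensity p β b v z
      ≤ ∫ z, liouvilleDensity p β b v z * φ z := by
    calc ∫ z in ball (0 : ℂ) 1, liouvilleDensity p β b v z
        = ∫ z in ball (0 : ℂ) 1, liouvilleDensity p β b v z * φ z := by
          refine setIntegral_congr_fun measurableSet_ball fun z hz => ?_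
          rw [φ.one_of_mem_closedBall (ball_subset_closedBall hz), mul_one]
      _ ≤ _ := setIntegral_le_integral hi (Eventually.of_forall fun z =>
          mul_nonneg (liouvilleDensity_nonneg p β b v z) φ.nonneg)
  have hw := integral_pulledBack_mul_laplacian hp h0 hβ h hφ φ.hasCompactSupport hφU
  have h2 : Integrable fun z => pulledBack p β v z * Laplacian.laplacian (⇑φ) z :=
    integrable_mul_of_continuousAt_tsupport (continuous_laplacian hφ)
      (hasCompactSupport_laplacian φ.hasCompactSupport) fun z hz => by
        have : ‖z‖ < 2 := by simpa using hφU (tsupport_laplacian_subset φ hz)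
        exact continuousAt_pulledBack hp h0 hβ h.continuous this.le
  have h3 : Integrable fun z => pulledBack p β v 1 * Laplacian.laplacian (⇑φ) z :=
    ((continuous_laplacian hφ).integrable_of_hasCompactSupport
      (hasCompactSupport_laplacian φ.hasCompactSupport)).const_mul _
  have h4 : ∫ z, liouvilleDensity p β b v z * φ z
      = ∫ z, (pulledBack p β v 1 * Laplacian.laplacian (⇑φ) z
        - pulledBack p β v z * Laplacian.laplacian (⇑φ) z) := by
    rw [integral_sub h3 h2, integral_const_mul, integral_laplacian_eq_zero hφ φ.hasCompactSupport]
    linarith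
  have h5 : ∫ z, (pulledBack p β v 1 * Laplacian.laplacian (⇑φ) z
      - pulledBack p β v z * Laplacian.laplacian (⇑φ) z)
      ≤ ∫ z, D * |Laplacian.laplacian (⇑φ) z| := by
    refine integral_mono (h3.sub h2) (hΔi.const_mul D) fun z => ?_
    simp only
    rw [← sub_mul]
    by_cases hz1 : ‖z‖ < 1
    · have e : φ =ᶠ[𝓝 z] fun _ => (1 : ℝ) :=
        φ.eventuallyEq_one_of_mem_ball (by simpa using hz1)
      simp [(laplacian_congr_nhds e).eq_of_nhds]
    by_cases hz2 : z ∈ tsupport φ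
    · have hz2 : ‖z‖ < 2 := by simpa using hφU hz2
      rw [not_lt] at hz1
      have hz0 : z ≠ 0 := norm_pos_iff.1 (by linarith)
      refine (le_abs_self _).trans ?_
      rw [abs_mul]
      gcongr
      refine (abs_pulledBack_sub_le hp h0 hβ h hC one_ne_zero hz0 (by simp) hz2.le).trans ?_
      have hC0 : 0 ≤ C := (abs_nonneg _).trans (hC _ ⟨maxRadius_pos p, le_rfl⟩)
      have hl1 : 0 ≤ Real.log ‖z‖ := Real.log_nonneg hz1
      have hl2 : Real.log ‖z‖ ≤ 1 := by
        have := Real.log_le_sub_one_of_pos (norm_pos_iff.2 hz0); linarith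
      have hl : |Real.log ‖(1 : ℂ)‖ - Real.log ‖z‖| ≤ 1 := by
        rw [norm_one, Real.log_one, zero_sub, abs_neg, abs_of_nonneg hl1]; exact hl2
      simp only [D]
      gcongr
    · simp [laplacian_zero_of_notMem_tsupport hz2]
  linarith

lemma exists_isBoundaryHarmonicPart {u : ℂ → ℝ} (hu : ContinuousOn u (closedBall 0 1)) :
    ∃ ψ, IsBoundaryHarmonicPart u ψ := by
  obtain ⟨ψ, h1, h2, h3⟩ := exists_harmonic_extension
    (f := fun x => u x - Real.circleAverage u 0 1)
    ((hu.mono sphere_subset_closedBall).sub continuousOn_const)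
  exact ⟨ψ, h1, h2, h3⟩

lemma hasFDerivAt_conformalCorrection_zero (p β : ℝ) :
    HasFDerivAt (conformalCorrection p β) ((2 * β + p * β) • Complex.reCLM) 0 := by
  have h1 : HasFDerivAt (fun z : ℂ => 1 + (β : ℂ) * z) _ 0 :=
    (((ContinuousLinearMap.id ℝ ℂ).hasFDerivAt (x := 0)).const_mul (β : ℂ)).const_add 1
  have h2 : HasFDerivAt (fun y : ℂ => Real.log ‖y‖) _ (1 + (β : ℂ) * 0) :=
    hasFDerivAt_log_norm (by simp)
  have h3 : HasFDerivAt (conformalCorrection p β) _ 0 :=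
    ((h2.comp (0 : ℂ) h1).const_mul 2).add (Complex.reCLM.hasFDerivAt.const_mul (p * β))
  refine h3.congr_fderiv ?_
  ext e
  simp [Complex.inner]
  ring

/-- On the unit circle a profile of mass close to `2` differs little from
`-2 log (conformalRadius p β z)`, hence the solution differs little, up to a constant, from
`conformalCorrection p β z - 2 p β Re z`. The gradient of this harmonic function at the origin
is `β (2 - p)`, which does not vanish unless `p = 2`. -/
lemma abs_fderiv_boundaryHarmonicPart_sub_le (hp : 0 < p) (h0 : 0 ≤ β) (hβ : β ≤ 1 / 4) {η : ℝ}
    {c : ℝ} {ψ : ℂ → ℝ} {κ : ℝ → ℝ} (h : IsRadialProfile c κ (maxRadius p) v g f)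
    (hη : ∀ s ∈ Icc (Real.exp (-(p / 4))) (Real.exp (p / 4)), |s * g s - 2| ≤ η)
    (hψ : IsBoundaryHarmonicPart (pulledBack p β v) ψ) :
    |fderiv ℝ ψ 0 1 - β * (2 - p)| ≤ 2 * (η * (p * β)) := by
  set q : ℂ → ℝ := fun z =>
    conformalCorrection p β z - 2 * p * β * z.re
      + (v 1 - Real.circleAverage (pulledBack p β v) 0 1)
  have hle : ∀ z ∈ closedBall (0 : ℂ) 1, ‖z‖ ≤ 2 := fun z hz => by
    have : ‖z‖ ≤ 1 := by simpa using hz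
    linarith
  have hq : HarmonicOnNhd q (closedBall 0 1) := fun z hz =>
    ((harmonicAt_conformalCorrection p β (one_add_ne_zero h0 hβ (hle z hz))).sub
      (harmonicAt_const_mul_re (2 * p * β) z)).add (harmonicAt_const _)
  have hqd : fderiv ℝ q 0 1 = β * (2 - p) := by
    have h1 : HasFDerivAt q _ 0 := ((hasFDerivAt_conformalCorrection_zero p β).sub
      (Complex.reCLM.hasFDerivAt.const_mul (2 * p * β))).add_const _
    rw [h1.fderiv]
    simp
    ring
  have hχ := abs_fderiv_zero_le_of_harmonic (χ := fun z => ψ z - q z) (ε := η * (p * β))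
    (hψ.continuousOn.sub fun z hz => (hq z hz).1.continuousAt.continuousWithinAt)
    (hψ.harmonic.sub (hq.mono ball_subset_closedBall)) (fun z hz => ?_)
  · have h00 : (0 : ℂ) ∈ ball (0 : ℂ) 1 := by simp
    rw [fderiv_fun_sub ((hψ.harmonic 0 h00).1.differentiableAt two_ne_zero)
      ((hq 0 (ball_subset_closedBall h00)).1.differentiableAt two_ne_zero)] at hχ
    simpa [hqd] using hχ
  · have hz1 : ‖z‖ = 1 := by simpa using hz
    have hz0 : z ≠ 0 := norm_pos_iff.1 (by linarith)
    have hre : |β * z.re| ≤ β := by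
      rw [abs_mul, abs_of_nonneg h0]
      exact mul_le_of_le_one_right h0 (hz1 ▸ Complex.abs_re_le_norm z)
    have hlog : Real.log (conformalRadius p β z) = p * (β * z.re) := by
      rw [log_conformalRadius hz0, hz1, Real.log_one, zero_add]
    have hmem : conformalRadius p β z ∈ Icc (Real.exp (-(p / 4))) (Real.exp (p / 4)) := by
      rw [← Real.exp_log (conformalRadius_pos (p := p) (β := β) hz0), hlog]
      have := abs_le.1 hre
      constructor <;> apply Real.exp_le_exp.2 <;> nlinarith
    have h1mem : (1 : ℝ) ∈ Icc (Real.exp (-(p / 4))) (Real.exp (p / 4)) :=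
      ⟨Real.exp_le_one_iff.2 (by linarith), Real.one_le_exp (by positivity)⟩
    have hmain := h.abs_add_mul_log_sub_le (Real.exp_pos _) hη hmem h1mem
    rw [Real.log_one, sub_zero, mul_zero, add_zero, hlog] at hmain
    have hη0 : 0 ≤ η := (abs_nonneg _).trans (hη 1 h1mem)
    have e : ψ z - q z = v (conformalRadius p β z) + 2 * (p * (β * z.re)) - v 1 := by
      rw [hψ.boundary z hz]
      simp only [q]
      rw [pulledBack]
      ring
    rw [e]
    refine hmain.trans ?_
    rw [abs_mul, abs_of_pos hp]
    gcongr

end Solution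

theorem theorem1p1 (α : ℝ) (hα : -1 < α) (hα_nonint : ∀ n : ℕ, α ≠ n) :
    ∃ h u ψ : ℕ → ℂ → ℝ,
      (∃ c₁ : ℝ, 0 < c₁ ∧ CoefficientBounds h c₁) ∧
      (∀ k, IsLiouvilleSolution α (h k) (u k)) ∧
      (∀ k, IsBoundaryHarmonicPart (u k) (ψ k)) ∧
      (∃ c : ℝ, 0 < c ∧ ∀ k,
        c ≤ ‖gradient (fun x => Real.log (h k x)) 0 + gradient (ψ k) 0‖ ∧
        c ≤ |Laplacian.laplacian (fun x => Real.log (h k x)) 0|) ∧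
      BlowsUpOnlyAtOrigin u ∧
      BoundedBoundaryOscillation u ∧
      BoundedEnergy α h u ∧
      SphericalHarnack u := by
  have hα0 : α ≠ 0 := by simpa using hα_nonint 0
  have hα' : 0 < |α| := abs_pos.2 hα0
  set p : ℝ := 2 + 2 * α
  have hp : 0 < p := by simp only [p]; linarith
  have hpα : 2 * α = p - 2 := by simp only [p]; ring
  set β : ℝ := 1 / 4
  have hβ0 : 0 < β := by norm_num [β]
  have h0 : 0 ≤ β := hβ0.le
  have hβ : β ≤ 1 / 4 := le_rfl
  -- With this `η` the error in the gradient of `ψ` is at most half of its main term `-2 α β`.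
  obtain ⟨b, C, v, g, f, hb, hC0, hv, hlim, hmass, hdens, hη⟩ :=
    exists_radialProfile_family (η := |α| / (2 * p)) hp (by positivity)
  have hsol : ∀ k, IsLiouvilleSolution α (expCoefficient b β) (pulledBack p β (v k)) := fun k =>
    isLiouvilleSolution_pulledBack hpα hp h0 hβ (hv k)
  choose ψ hψ using fun k => exists_isBoundaryHarmonicPart (hsol k).continuousOn
  have hHarnack : ∀ k, ∀ r : ℝ, 0 < r → r ≤ 1 → ∀ x ∈ sphere (0 : ℂ) r, ∀ y ∈ sphere (0 : ℂ) r,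
      |pulledBack p β (v k) x - pulledBack p β (v k) y| ≤ C * p + 2 * (2 + p) := by
    intro k r hr hr1 x hx y hy
    have hx' : ‖x‖ = r := by simpa using hx
    have hy' : ‖y‖ = r := by simpa using hy
    have := abs_pulledBack_sub_le hp h0 hβ (hv k) (hmass k) (norm_pos_iff.1 (hx' ▸ hr))
      (norm_pos_iff.1 (hy' ▸ hr)) (by linarith) (by linarith)
    simpa [hx', hy'] using this
  refine ⟨fun _ => expCoefficient b β, fun k => pulledBack p β (v k), ψ,
    exists_coefficientBounds hb β, hsol, hψ,
    ⟨min (|α| * β) (4 * b), by positivity, fun k => ⟨?_, ?_⟩⟩,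
    ⟨⟨fun _ => 0, by simp, tendsto_const_nhds, ?_⟩, ?_⟩,
    ⟨C * p + 2 * (2 + p), fun k x hx y hy => hHarnack k 1 one_pos le_rfl x hx y hy⟩, ?_,
    ⟨C * p + 2 * (2 + p), fun k r hr hr1 x hx y hy => hHarnack k r hr hr1.le x hx y hy⟩⟩
  · rw [gradient_log_expCoefficient_zero, zero_add]
    refine (min_le_left _ _).trans ?_
    have h1 := abs_fderiv_boundaryHarmonicPart_sub_le hp h0 hβ (hv k) (hη k) (hψ k)
    have h2 : |fderiv ℝ (ψ k) 0 1| ≤ ‖gradient (ψ k) 0‖ := by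
      rw [← inner_gradient_left]
      simpa using abs_real_inner_le_norm (gradient (ψ k) 0) (1 : ℂ)
    have h3 : |β * (2 - p)| = 2 * (|α| * β) := by
      rw [show β * (2 - p) = -(2 * β) * α by simp only [p]; ring, abs_mul, abs_neg,
        abs_of_nonneg (by positivity)]
      ring
    have h4 : 2 * (|α| / (2 * p) * (p * β)) = |α| * β := by field_simp
    have h5 := abs_sub_abs_le_abs_sub (β * (2 - p)) (fderiv ℝ (ψ k) 0 1)
    rw [abs_sub_comm, h3] at h5
    rw [h4] at h1
    linarith
  · have h4b : 0 < 4 * b := by positivity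
    rw [laplacian_log_expCoefficient_zero, abs_of_pos h4b]
    exact min_le_right _ _
  · have e : ∀ k, pulledBack p β (v k) 0 = v k 0 := fun k => by
      simp [pulledBack, conformalRadius, conformalCorrection, Real.zero_rpow hp.ne']
    simpa only [e] using hlim
  · rintro σ - q - ⟨x, hx, hxq, hux⟩
    by_contra hq0
    have hr : 0 < ‖q‖ / 2 := by have := norm_pos_iff.2 hq0; positivity
    have h1 : ∀ᶠ k in atTop, ‖q‖ / 2 < ‖x k‖ :=
      hxq.norm.eventually (lt_mem_nhds (by linarith))
    obtain ⟨k, hk1, hk2⟩ := (h1.and (hux.eventually_gt_atTop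
      (Real.log C - p * (Real.log (‖q‖ / 2) - 1 / 2) + (2 + p)))).exists
    have hxk : ‖x k‖ < 1 := by simpa using hx k
    have := pulledBack_le hp h0 hβ (hdens (σ k)) hr hk1.le (by linarith)
    linarith
  · obtain ⟨A, hA⟩ := setIntegral_liouvilleDensity_le (b := b) (C := C) hp h0 hβ
    refine ⟨A, fun k => ?_⟩
    rw [hpα]
    exact ⟨(integrableOn_liouvilleDensity hp h0 hβ (hv k).continuous).mono_set
      (ball_subset_ball one_le_two), hA _ _ _ (hv k) (hmass k)⟩
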